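/- Let $I$ be an index set, $\mathcal U$ an ultrafilter on $I$, and $(k_i)_{i\in I}$ fields. For a family of sets $(E_i)$ let $\prod_{\mathcal U}E_i$ be its ultraproduct (families modulo equality for $\mathcal U$-almost every $i$), with $[x_i]$ the class of $(x_i)$. Then $k=\prod_{\mathcal U}k_i$ is a field, and an ultraproduct of $k_i$-vector spaces is a $k$-vector space. A *tannakian category over a field $k$* is a $k$-linear abelian category with a $k$-bilinear symmetric monoidal structure, with unit object $\underline 1$, such that every object has a dual (rigidity) and $k\to\operatorname{End}(\underline 1)$, $a\mapsto a\cdot\mathrm{id}$, is bijective. A *fibre functor* on it is an exact, faithful, $k$-linear symmetric monoidal functor $\omega$ to the category $\mathrm{Vec}_k$ of finite-dimensional $k$-vector spaces; its structure isomorphisms are written $c_{X,Y}:\omega(X)\otimes\omega(Y)\to\omega(X\otimes Y)$ and $e:k\to\omega(\underline 1)$. Let $\mathcal C_i$ be (small) categories with preadditive, $k_i$-linear and symmetric monoidal structures, and $\omega_i:\mathcal C_i\to \mathrm{Vec}_{k_i}$ symmetric monoidal functors. The *ultraproduct* $\prod_{\mathcal U}\mathcal C_i$ has as objects $[X_i]$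 the families of objects $X_i$ of $\mathcal C_i$, with $\operatorname{Hom}([X_i],[Y_i])=\prod_{\mathcal U}\operatorname{Hom}(X_i,Y_i)$; composition, addition, scalar multiplication by $k$, tensor product, unit and constraints are formed componentwise. (Families that agree for almost every $i$ are canonically isomorphic; identifying them changes the category only by an equivalence.) The *restricted ultraproduct* $\prod_R\mathcal C_i$ is the full subcategory, with the inherited structure, of those $[X_i]$ for which there is $n$ with $\dim_{k_i}\omega_i(X_i)\le n$ for $\mathcal U$-almost every $i$. Define $$\omega:\textstyle\prod_R\mathcal C_i\to\mathrm{Vec}_k,\qquad \omega([X_i])=\prod_{\mathcal U}\omega_i(X_i),\qquad \omega([f_i])=[\omega_i(f_i)].$$ **(1)** If every $\mathcal C_i$ is tannakian over $k_i$ and every $\omega_i$ is a fibre functor on it, then $\prod_R\mathcal C_i$ is a tannakian category over $k=\prod_{\mathcal U}k_i$, and $\omega$ is a fibre functor on it, with the tensor structure determined by $c_{[X_i],[Y_i]}([v_i]\otimes[w_i])=[c_{X_i,Y_i}(v_i\otimes w_i)]$ and $e([a_i])=[e_i(a_i)]$. **(2)** Let $G_i$ be affine group schemes over $k_i$, let $\mathrm{Rep}_{k_i}G_i$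 be the category of finite-dimensional representations of $G_i$, i.e. of finite-dimensional comodules over the commutative Hopf algebra representing $G_i$, and let $\omega_i$ be the forgetful functors. Then there are an affine group scheme $G$ over $k=\prod_{\mathcal U}k_i$ and a $k$-linear symmetric monoidal equivalence of categories $\prod_R\mathrm{Rep}_{k_i}G_i\simeq\mathrm{Rep}_kG$. -/

import Mathlib

open CategoryTheory MonoidalCategory Limits
open scoped TensorProduct

universe w₀ u v₁ u₁

/-! ### Ultraproducts of sets, fields and vector spaces -/

/-- The ultraproduct `∏_U E i`: families `(x i)` modulo equality for `U`-almost every `i`. -/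
def UProd {I : Type w₀} (U : Ultrafilter I) (E : I → Type u) : Type (max w₀ u) :=
  (U : Filter I).Product E

namespace UProd

variable {I : Type w₀} {U : Ultrafilter I}

section Basic

variable {E F G : I → Type*}

/-- The class `[x i]` of a family. -/
def mk (U : Ultrafilter I) {E : I → Type u} (x : ∀ i, E i) : UProd U E :=
  Quotient.mk ((U : Filter I).productSetoid E) x

theorem ind {p : UProd U E → Prop} (h : ∀ x : ∀ i, E i, p (mk U x)) (x : UProd U E) : p x :=
  Quotient.ind h x

theorem mk_eq_mk {x y : ∀ i, E i} : mk U x = mk U y ↔ ∀ᶠ i in (U : Filter I), x i = y i :=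
  Quotient.eq (r := (U : Filter I).productSetoid E)

theorem mk_congr {x y : ∀ i, E i} (h : ∀ i, x i = y i) : mk U x = mk U y :=
  congrArg (mk U) (funext h)

/-- The ultraproduct of unary operations. -/
def map (f : ∀ i, E i → F i) : UProd U E → UProd U F :=
  Quotient.lift (fun x => mk U fun i => f i (x i)) fun _ _ h =>
    mk_eq_mk.2 (Filter.Eventually.mono h fun i hi => congrArg (f i) hi)

/-- The ultraproduct of binary operations. -/
def map₂ (f : ∀ i, E i → F i → G i) : UProd U E → UProd U F → UProd U G :=
  Quotient.lift₂ (fun x y => mk U fun i => f i (x i) (y i)) fun _ _ _ _ h h' =>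
    mk_eq_mk.2 ((Filter.Eventually.and h h').mono fun i hi => congrArg₂ (f i) hi.1 hi.2)

@[simp] theorem map_mk (f : ∀ i, E i → F i) (x : ∀ i, E i) :
    map f (mk U x) = mk U fun i => f i (x i) := rfl

@[simp] theorem map₂_mk (f : ∀ i, E i → F i → G i) (x : ∀ i, E i) (y : ∀ i, F i) :
    map₂ f (mk U x) (mk U y) = mk U fun i => f i (x i) (y i) := rfl

end Basic

section Algebra

variable {k : I → Type*} {V : I → Type*}

instance [∀ i, AddCommGroup (V i)] : Zero (UProd U V) := ⟨mk U fun _ => 0⟩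

instance [∀ i, AddCommGroup (V i)] : Add (UProd U V) := ⟨map₂ fun _ a b => a + b⟩

instance [∀ i, AddCommGroup (V i)] : Neg (UProd U V) := ⟨map fun _ a => -a⟩

instance [∀ i, AddCommGroup (V i)] : AddCommGroup (UProd U V) where
  sub := map₂ fun _ a b => a - b
  nsmul := nsmulRec
  zsmul := zsmulRec
  add_assoc := ind fun _ => ind fun _ => ind fun _ => mk_congr fun _ => add_assoc _ _ _
  zero_add := ind fun _ => mk_congr fun _ => zero_add _
  add_zero := ind fun _ => mk_congr fun _ => add_zero _
  add_comm := ind fun _ => ind fun _ => mk_congr fun _ => add_comm _ _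
  neg_add_cancel := ind fun _ => mk_congr fun _ => neg_add_cancel _
  sub_eq_add_neg := ind fun _ => ind fun _ => mk_congr fun _ => sub_eq_add_neg _ _

theorem mk_zero [∀ i, AddCommGroup (V i)] : mk U (fun i => (0 : V i)) = 0 := rfl

theorem mk_add [∀ i, AddCommGroup (V i)] (x y : ∀ i, V i) :
    mk U x + mk U y = mk U fun i => x i + y i := rfl

theorem mk_sum [∀ i, AddCommGroup (V i)] {J : Type*} (s : Finset J) (x : J → ∀ i, V i) :
    ∑ j ∈ s, mk U (x j) = mk U fun i => ∑ j ∈ s, x j i := by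
  classical
  induction s using Finset.induction_on with
  | empty => simp only [Finset.sum_empty]; rfl
  | insert a s ha ih => simp only [Finset.sum_insert ha, ih]; rfl

instance [∀ i, Field (k i)] : CommRing (UProd U k) where
  mul := map₂ fun _ a b => a * b
  one := mk U fun _ => 1
  mul_assoc := ind fun _ => ind fun _ => ind fun _ => mk_congr fun _ => mul_assoc _ _ _
  one_mul := ind fun _ => mk_congr fun _ => one_mul _
  mul_one := ind fun _ => mk_congr fun _ => mul_one _
  mul_comm := ind fun _ => ind fun _ => mk_congr fun _ => mul_comm _ _
  left_distrib := ind fun _ => ind fun _ => ind fun _ => mk_congr fun _ => left_distrib _ _ _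
  right_distrib := ind fun _ => ind fun _ => ind fun _ => mk_congr fun _ => right_distrib _ _ _
  zero_mul := ind fun _ => mk_congr fun _ => zero_mul _
  mul_zero := ind fun _ => mk_congr fun _ => mul_zero _
  zsmul := zsmulRec
  neg_add_cancel := neg_add_cancel
  sub_eq_add_neg := sub_eq_add_neg

/-- The ultraproduct of fields is a field. -/
noncomputable instance [∀ i, Field (k i)] : Field (UProd U k) where
  inv := map fun _ a => a⁻¹
  exists_pair_ne := ⟨mk U fun _ => 0, mk U fun _ => 1, fun h => by
    obtain ⟨i, hi⟩ := (mk_eq_mk.1 h).exists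
    exact zero_ne_one hi⟩
  mul_inv_cancel := ind fun a ha => by
    have h : ∀ᶠ i in (U : Filter I), a i ≠ 0 :=
      Ultrafilter.eventually_not.2 fun h => ha (mk_eq_mk.2 h)
    exact mk_eq_mk.2 (h.mono fun i hi => mul_inv_cancel₀ hi)
  inv_zero := mk_congr fun _ => inv_zero
  nnqsmul := _
  nnqsmul_def := fun _ _ => rfl
  qsmul := _
  qsmul_def := fun _ _ => rfl

/-- The ultraproduct of `k i`-vector spaces is a vector space over the ultraproduct of the `k i`,
with `[a i] • [v i] = [a i • v i]`. -/
instance [∀ i, Field (k i)] [∀ i, AddCommGroup (V i)] [∀ i, Module (k i) (V i)] :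
    Module (UProd U k) (UProd U V) where
  smul := map₂ fun _ a x => a • x
  one_smul := ind fun _ => mk_congr fun _ => one_smul _ _
  mul_smul := ind fun _ => ind fun _ => ind fun _ => mk_congr fun _ => mul_smul _ _ _
  smul_zero := ind fun _ => mk_congr fun _ => smul_zero _
  smul_add := ind fun _ => ind fun _ => ind fun _ => mk_congr fun _ => smul_add _ _ _
  add_smul := ind fun _ => ind fun _ => ind fun _ => mk_congr fun _ => add_smul _ _ _
  zero_smul := ind fun _ => mk_congr fun _ => zero_smul _ _

theorem mk_smul [∀ i, Field (k i)] [∀ i, AddCommGroup (V i)] [∀ i, Module (k i) (V i)]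
    (a : ∀ i, k i) (x : ∀ i, V i) : mk U a • mk U x = mk U fun i => a i • x i := rfl

/-- The ultraproduct of vector spaces of bounded finite dimension is finite-dimensional. -/
theorem finite_of_bounded [∀ i, Field (k i)] [∀ i, AddCommGroup (V i)] [∀ i, Module (k i) (V i)]
    [∀ i, Module.Finite (k i) (V i)] (n : ℕ)
    (h : ∀ᶠ i in (U : Filter I), Module.finrank (k i) (V i) ≤ n) :
    Module.Finite (UProd U k) (UProd U V) := by
  classical
  have key : ∀ i, ∃ e : Fin n → V i, Module.finrank (k i) (V i) ≤ n →
      ∀ x : V i, ∃ a : Fin n → k i, ∑ j, a j • e j = x := by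
    intro i
    by_cases hi : Module.finrank (k i) (V i) ≤ n
    · let b := Module.finBasis (k i) (V i)
      refine ⟨fun j => if hj : (j : ℕ) < Module.finrank (k i) (V i) then b ⟨j, hj⟩ else 0,
        fun _ x => ⟨fun j => if hj : (j : ℕ) < Module.finrank (k i) (V i)
          then b.repr x ⟨j, hj⟩ else 0, ?_⟩⟩
      conv_rhs => rw [← b.sum_repr x]
      symm
      refine Finset.sum_of_injOn (Fin.castLE hi) (Fin.castLE_injective hi).injOn
        (fun _ _ => Finset.mem_coe.2 (Finset.mem_univ _)) ?_ ?_
      · intro j _ hj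
        have : ¬ (j : ℕ) < Module.finrank (k i) (V i) := fun hj' =>
          hj ⟨⟨j, hj'⟩, by simp, rfl⟩
        simp [this]
      · intro j _
        simp
    · exact ⟨0, fun h => absurd h hi⟩
  choose e he using key
  refine ⟨⟨Finset.univ.image fun j => mk U fun i => e i j, ?_⟩⟩
  rw [eq_top_iff]
  rintro x -
  revert x
  refine ind fun x => ?_
  have hx : ∀ i, ∃ a : Fin n → k i, Module.finrank (k i) (V i) ≤ n → ∑ j, a j • e i j = x i := by
    intro i
    by_cases hi : Module.finrank (k i) (V i) ≤ n
    · obtain ⟨a, ha⟩ := he i hi (x i)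
      exact ⟨a, fun _ => ha⟩
    · exact ⟨0, fun h => absurd h hi⟩
  choose a ha using hx
  have : mk U x = ∑ j, (mk U fun i => a i j) • (mk U fun i => e i j) := by
    simp only [mk_smul, mk_sum]
    exact mk_eq_mk.2 (h.mono fun i hi => (ha i hi).symm)
  rw [this]
  refine Submodule.sum_mem _ fun j _ => Submodule.smul_mem _ _ (Submodule.subset_span ?_)
  simp

end Algebra

end UProd

/-! ### The ultraproduct of categories -/

/-- The ultraproduct `∏_U C i` of categories. An object `[X i]` is given by a family of objects
`X i` of `C i`, and `Hom([X i], [Y i])` is the ultraproduct of the sets `Hom(X i, Y i)`.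
(Families which agree for almost every `i` are canonically isomorphic through `[𝟙 (X i)]`; they
are not forced to be equal as objects.) -/
structure UProdCat {I : Type u} (U : Ultrafilter I) (C : I → Type u₁) where
  /-- The `i`-th member of the family. -/
  obj : ∀ i, C i

namespace UProdCat

variable {I : Type u} {U : Ultrafilter I} {C : I → Type u₁} [∀ i, Category.{u} (C i)]

open UProd (ind mk_congr)

instance : Category.{u} (UProdCat U C) where
  Hom X Y := UProd U fun i => X.obj i ⟶ Y.obj i
  id X := UProd.mk U fun i => 𝟙 (X.obj i)
  comp := UProd.map₂ fun _ f g => f ≫ g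
  id_comp := ind fun _ => mk_congr fun _ => Category.id_comp _
  comp_id := ind fun _ => mk_congr fun _ => Category.comp_id _
  assoc := ind fun _ => ind fun _ => ind fun _ => mk_congr fun _ => Category.assoc _ _ _

/-- The morphism `[f i]`. -/
def homMk {X Y : UProdCat U C} (f : ∀ i, X.obj i ⟶ Y.obj i) :
    X ⟶ Y := UProd.mk U f

/-- The isomorphism `[e i]`. -/
def isoMk {X Y : UProdCat U C} (e : ∀ i, X.obj i ≅ Y.obj i) : X ≅ Y where
  hom := homMk fun i => (e i).hom
  inv := homMk fun i => (e i).inv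
  hom_inv_id := mk_congr fun i => (e i).hom_inv_id
  inv_hom_id := mk_congr fun i => (e i).inv_hom_id

instance [∀ i, Preadditive (C i)] : Preadditive (UProdCat U C) where
  homGroup X Y := inferInstanceAs (AddCommGroup (UProd U fun i => X.obj i ⟶ Y.obj i))
  add_comp _ _ _ := ind fun _ => ind fun _ => ind fun _ =>
    mk_congr fun _ => Preadditive.add_comp _ _ _ _ _ _
  comp_add _ _ _ := ind fun _ => ind fun _ => ind fun _ =>
    mk_congr fun _ => Preadditive.comp_add _ _ _ _ _ _

instance {k : I → Type u} [∀ i, Field (k i)] [∀ i, Preadditive (C i)] [∀ i, Linear (k i) (C i)] :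
    Linear (UProd U k) (UProdCat U C) where
  homModule X Y := inferInstanceAs (Module (UProd U k) (UProd U fun i => X.obj i ⟶ Y.obj i))
  smul_comp _ _ _ := ind fun _ => ind fun _ => ind fun _ =>
    mk_congr fun _ => Linear.smul_comp _ _ _ _ _ _
  comp_smul _ _ _ := ind fun _ => ind fun _ => ind fun _ =>
    mk_congr fun _ => Linear.comp_smul _ _ _ _ _ _

variable [∀ i, MonoidalCategory (C i)]

instance : MonoidalCategoryStruct (UProdCat U C) where
  tensorObj X Y := ⟨fun i => X.obj i ⊗ Y.obj i⟩
  tensorUnit := ⟨fun i => 𝟙_ (C i)⟩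
  whiskerLeft X _ _ := UProd.map fun i f => X.obj i ◁ f
  whiskerRight f Y := UProd.map (fun i f => f ▷ Y.obj i) f
  tensorHom := UProd.map₂ fun _ f g => f ⊗ₘ g
  associator X Y Z := isoMk fun i => α_ (X.obj i) (Y.obj i) (Z.obj i)
  leftUnitor X := isoMk fun i => λ_ (X.obj i)
  rightUnitor X := isoMk fun i => ρ_ (X.obj i)

/-- The tensor product of the ultraproduct: `[X i] ⊗ [Y i] = [X i ⊗ Y i]`, and likewise for
morphisms and constraints. -/
instance : MonoidalCategory (UProdCat U C) where
  tensorHom_def := ind fun _ => ind fun _ => mk_congr fun _ => tensorHom_def _ _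
  id_tensorHom_id _ _ := mk_congr fun _ => id_tensorHom_id _ _
  tensorHom_comp_tensorHom := ind fun _ => ind fun _ => ind fun _ => ind fun _ =>
    mk_congr fun _ => tensorHom_comp_tensorHom _ _ _ _
  whiskerLeft_id _ _ := mk_congr fun _ => whiskerLeft_id _ _
  id_whiskerRight _ _ := mk_congr fun _ => id_whiskerRight _ _
  associator_naturality := ind fun _ => ind fun _ => ind fun _ =>
    mk_congr fun _ => associator_naturality _ _ _
  leftUnitor_naturality := ind fun _ => mk_congr fun _ => leftUnitor_naturality _
  rightUnitor_naturality := ind fun _ => mk_congr fun _ => rightUnitor_naturality _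
  pentagon _ _ _ _ := mk_congr fun _ => pentagon _ _ _ _
  triangle _ _ := mk_congr fun _ => triangle _ _

instance [∀ i, SymmetricCategory (C i)] : SymmetricCategory (UProdCat U C) where
  braiding X Y := isoMk fun i => β_ (X.obj i) (Y.obj i)
  braiding_naturality_right _ _ _ := ind fun _ =>
    mk_congr fun _ => BraidedCategory.braiding_naturality_right _ _
  braiding_naturality_left := ind fun _ _ =>
    mk_congr fun _ => BraidedCategory.braiding_naturality_left _ _
  hexagon_forward _ _ _ := mk_congr fun _ => BraidedCategory.hexagon_forward _ _ _
  hexagon_reverse _ _ _ := mk_congr fun _ => BraidedCategory.hexagon_reverse _ _ _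
  symmetry _ _ := mk_congr fun _ => SymmetricCategory.symmetry _ _

end UProdCat

/-! ### Tannakian categories and fibre functors -/

section Tannakian

variable (k : Type u) [Field k] (C : Type u₁) [Category.{v₁} C] [Preadditive C] [Linear k C]
  [MonoidalCategory C] [SymmetricCategory C]

/-- A tannakian category over `k`: a rigid abelian tensor category in which
`End(𝟙_)` is the field `k`, acting on all morphisms by the tensor product. -/
class IsTannakian : Prop where
  hasFiniteProducts : HasFiniteProducts C
  hasKernels : HasKernels C
  hasCokernels : HasCokernels C
  isNormalMonoCategory : IsNormalMonoCategory C
  isNormalEpiCategory : IsNormalEpiCategory C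
  monoidalPreadditive : MonoidalPreadditive C
  monoidalLinear : MonoidalLinear k C
  rigid : Nonempty (RigidCategory C)
  bijective_end_unit : Function.Bijective fun a : k => a • 𝟙 (𝟙_ C)

variable {C}

/-- A fibre functor: an exact, faithful, `k`-linear tensor functor to the category of
finite-dimensional `k`-vector spaces. The tensor structure of `ω`, symmetric and compatible with
associativity and unit constraints, is the datum `[ω.Braided]`. -/
class IsFibreFunctor (ω : C ⥤ FGModuleCat.{u} k) [ω.Braided] : Prop where
  faithful : ω.Faithful
  additive : ω.Additive
  linear : ω.Linear k
  preservesFiniteLimits : PreservesFiniteLimits ω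
  preservesFiniteColimits : PreservesFiniteColimits ω

end Tannakian

/-! ### The restricted ultraproduct -/

section Restricted

variable {I : Type u} (U : Ultrafilter I) {k : I → Type u} [∀ i, Field (k i)]
  {C : I → Type u₁} [∀ i, Category.{u} (C i)] (ω : ∀ i, C i ⥤ FGModuleCat.{u} (k i))

/-- The objects `[X i]` such that the dimension of `ω i (X i)` is almost everywhere bounded. -/
def isBounded : ObjectProperty (UProdCat U C) := fun X =>
  ∃ n : ℕ, ∀ᶠ i in (U : Filter I), Module.finrank (k i) ((ω i).obj (X.obj i)) ≤ n

instance [∀ i, MonoidalCategory (C i)] [∀ i, (ω i).Monoidal] : (isBounded U ω).IsMonoidal where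
  prop_unit := ⟨1, Filter.Eventually.of_forall fun i => by
    have e := FGModuleCat.isoToLinearEquiv (Functor.Monoidal.εIso (ω i))
    exact (e.finrank_eq.symm.trans (Module.finrank_self (k i))).le⟩
  prop_tensor := by
    rintro X Y ⟨m, hm⟩ ⟨n, hn⟩
    refine ⟨m * n, (hm.and hn).mono fun i hi => ?_⟩
    have e := FGModuleCat.isoToLinearEquiv (Functor.Monoidal.μIso (ω i) (X.obj i) (Y.obj i))
    refine (e.finrank_eq.symm.trans (Module.finrank_tensorProduct (R := k i) (S := k i)
      (M := (ω i).obj (X.obj i)) (M' := (ω i).obj (Y.obj i)))).le.trans ?_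
    exact Nat.mul_le_mul hi.1 hi.2

/-- The restricted ultraproduct `∏_R C i`: the full subcategory of the ultraproduct on the objects
`[X i]` for which the dimension of `ω i (X i)` is almost everywhere bounded, with the inherited
linear and tensor structures. -/
abbrev ResProd := (isBounded U ω).FullSubcategory

/-- The functor `ω [X i] = ∏_U ω i (X i)`, `ω [f i] = [ω i (f i)]` on the restricted
ultraproduct. -/
noncomputable def resFunctor : ResProd U ω ⥤ FGModuleCat (UProd U k) where
  obj X :=
    haveI : Module.Finite (UProd U k) (UProd U fun i => (ω i).obj (X.obj.obj i)) :=
      UProd.finite_of_bounded X.property.choose X.property.choose_spec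
    FGModuleCat.of (UProd U k) (UProd U fun i => (ω i).obj (X.obj.obj i))
  map {X Y} f :=
    ConcreteCategory.ofHom (C := FGModuleCat (UProd U k))
      { toFun := UProd.map₂ (fun i g v => ((ω i).map g).hom.hom v) f.hom
        map_add' := by
          generalize f.hom = g
          revert g
          exact UProd.ind fun g => UProd.ind fun v => UProd.ind fun w =>
            UProd.mk_congr fun i => map_add _ _ _
        map_smul' := by
          generalize f.hom = g
          revert g
          exact UProd.ind fun g => UProd.ind fun a => UProd.ind fun v =>
            UProd.mk_congr fun i => map_smul _ _ _ }
  map_id X := by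
    apply FGModuleCat.hom_ext
    apply LinearMap.ext
    exact UProd.ind fun v => UProd.mk_congr fun i => by simp
  map_comp {X Y Z} f g := by
    apply FGModuleCat.hom_ext
    apply LinearMap.ext
    obtain ⟨f⟩ := f
    obtain ⟨g⟩ := g
    revert f g
    exact UProd.ind fun f => UProd.ind fun g => UProd.ind fun v => UProd.mk_congr fun i => by simp

end Restricted

/-! ### Representations of affine group schemes -/

section Rep

/-- The multiplication `(V ⊗ B) ⊗ (W ⊗ B) → (V ⊗ W) ⊗ B`,
`(v ⊗ a) ⊗ (w ⊗ b) ↦ (v ⊗ w) ⊗ a b`. -/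
noncomputable def tensorMul (k : Type*) [CommRing k] (V W B : Type*) [AddCommGroup V] [Module k V]
    [AddCommGroup W] [Module k W] [CommRing B] [Algebra k B] :
    (V ⊗[k] B) ⊗[k] (W ⊗[k] B) →ₗ[k] (V ⊗[k] W) ⊗[k] B :=
  (LinearMap.mul' k B).lTensor (V ⊗[k] W) ∘ₗ
    (TensorProduct.tensorTensorTensorComm k V B W B).toLinearMap

@[simp] theorem tensorMul_tmul {k : Type*} [CommRing k] {V W B : Type*} [AddCommGroup V]
    [Module k V] [AddCommGroup W] [Module k W] [CommRing B] [Algebra k B] (v : V) (w : W)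
    (a b : B) : tensorMul k V W B ((v ⊗ₜ a) ⊗ₜ (w ⊗ₜ b)) = (v ⊗ₜ w) ⊗ₜ (a * b) := by
  simp [tensorMul]

variable (k : Type u) [Field k] (A : Type u) [CommRing A] [HopfAlgebra k A]

/-- A finite-dimensional representation over `k` of the affine group scheme `G = Spec A`, where
`A` is a commutative Hopf algebra over `k`: a finite-dimensional vector space `V` with a coaction
`ρ : V → V ⊗ A` which is coassociative and counital. (The element `g` of
`G(R) = Hom_k(A, R)` acts on `V ⊗ R` as the `R`-linear extension of `(1 ⊗ g) ∘ ρ`.) -/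
structure FinRep where
  /-- The underlying vector space. -/
  V : FGModuleCat.{u} k
  /-- The coaction. -/
  ρ : V →ₗ[k] V ⊗[k] A
  coassoc : ∀ v : V, TensorProduct.assoc k V A A (ρ.rTensor A (ρ v)) =
    (CoalgebraStruct.comul (R := k) (A := A)).lTensor V (ρ v)
  counit : ∀ v : V, (CoalgebraStruct.counit (R := k) (A := A)).lTensor V (ρ v) = v ⊗ₜ[k] (1 : k)

namespace FinRep

variable {k A}

/-- The space of morphisms of representations: linear maps compatible with the coactions. -/
def homs (X Y : FinRep k A) : Submodule k (X.V ⟶ Y.V) where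
  carrier := {f | ∀ v : X.V, Y.ρ (f.hom.hom v) = f.hom.hom.rTensor A (X.ρ v)}
  add_mem' {f g} hf hg v := by
    change Y.ρ (f.hom.hom v + g.hom.hom v) = (f.hom.hom + g.hom.hom).rTensor A (X.ρ v)
    rw [map_add, hf v, hg v, LinearMap.rTensor_add, LinearMap.add_apply]
  zero_mem' v := by
    change Y.ρ 0 = (0 : X.V →ₗ[k] Y.V).rTensor A (X.ρ v)
    rw [map_zero, LinearMap.rTensor_zero, LinearMap.zero_apply]
  smul_mem' a f hf v := by
    change Y.ρ (a • f.hom.hom v) = (a • f.hom.hom).rTensor A (X.ρ v)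
    rw [map_smul, hf v, LinearMap.rTensor_smul, LinearMap.smul_apply]

instance : Category.{u} (FinRep k A) where
  Hom X Y := homs X Y
  id X := ⟨𝟙 X.V, fun v => by
    change X.ρ v = (LinearMap.id : X.V →ₗ[k] X.V).rTensor A (X.ρ v)
    rw [LinearMap.rTensor_id, LinearMap.id_apply]⟩
  comp {X Y Z} f g := ⟨f.1 ≫ g.1, fun v => by
    change Z.ρ (g.1.hom.hom (f.1.hom.hom v)) =
      (g.1.hom.hom ∘ₗ f.1.hom.hom).rTensor A (X.ρ v)
    rw [g.2, f.2, LinearMap.rTensor_comp, LinearMap.comp_apply]⟩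
  id_comp f := Subtype.ext (Category.id_comp _)
  comp_id f := Subtype.ext (Category.comp_id _)
  assoc f g h := Subtype.ext (Category.assoc _ _ _)

instance : Preadditive (FinRep k A) where
  homGroup X Y := inferInstanceAs (AddCommGroup (homs X Y))
  add_comp _ _ _ _ _ _ := Subtype.ext (Preadditive.add_comp _ _ _ _ _ _)
  comp_add _ _ _ _ _ _ := Subtype.ext (Preadditive.comp_add _ _ _ _ _ _)

instance : Linear k (FinRep k A) where
  homModule X Y := inferInstanceAs (Module k (homs X Y))
  smul_comp _ _ _ _ _ _ := Subtype.ext (Linear.smul_comp _ _ _ _ _ _)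
  comp_smul _ _ _ _ _ _ := Subtype.ext (Linear.comp_smul _ _ _ _ _ _)

variable (k A) in
/-- The forgetful functor to finite-dimensional vector spaces. -/
def forget : FinRep k A ⥤ FGModuleCat.{u} k where
  obj X := X.V
  map f := f.1

instance : (forget k A).Faithful where
  map_injective h := Subtype.ext h

/-- A morphism from a linear map compatible with the coactions. -/
def homMk {X Y : FinRep k A} (f : X.V ⟶ Y.V)
    (hf : ∀ v : X.V, Y.ρ (f.hom.hom v) = f.hom.hom.rTensor A (X.ρ v)) : X ⟶ Y := ⟨f, hf⟩

/-- An isomorphism from a linear isomorphism compatible with the coactions. -/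
def isoMk {X Y : FinRep k A} (e : X.V ≅ Y.V)
    (he : ∀ v : X.V, Y.ρ (e.hom.hom.hom v) = e.hom.hom.hom.rTensor A (X.ρ v)) : X ≅ Y where
  hom := homMk e.hom he
  inv := homMk e.inv fun v => by
    have h1 : ∀ x, e.inv.hom.hom (e.hom.hom.hom x) = x := fun x =>
      (FGModuleCat.isoToLinearEquiv e).symm_apply_apply x
    have h2 : e.hom.hom.hom (e.inv.hom.hom v) = v :=
      (FGModuleCat.isoToLinearEquiv e).apply_symm_apply v
    have h3 : e.inv.hom.hom ∘ₗ e.hom.hom.hom = LinearMap.id := LinearMap.ext h1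
    conv_rhs => rw [← h2, he, ← LinearMap.comp_apply, ← LinearMap.rTensor_comp, h3,
      LinearMap.rTensor_id, LinearMap.id_apply]
  hom_inv_id := Subtype.ext e.hom_inv_id
  inv_hom_id := Subtype.ext e.inv_hom_id

/-- The coaction on the tensor product:
`V ⊗ W → (V ⊗ A) ⊗ (W ⊗ A) → (V ⊗ W) ⊗ A`. -/
noncomputable def tensorCoact {V W : Type*} [AddCommGroup V] [Module k V] [AddCommGroup W]
    [Module k W] (ρ : V →ₗ[k] V ⊗[k] A) (σ : W →ₗ[k] W ⊗[k] A) :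
    V ⊗[k] W →ₗ[k] (V ⊗[k] W) ⊗[k] A :=
  tensorMul k V W A ∘ₗ TensorProduct.map ρ σ

theorem lTensor_tensorMul {V W B B' : Type*} [AddCommGroup V] [Module k V] [AddCommGroup W]
    [Module k W] [CommRing B] [Algebra k B] [CommRing B'] [Algebra k B'] (φ : B →ₐ[k] B')
    (x : V ⊗[k] B) (y : W ⊗[k] B) :
    φ.toLinearMap.lTensor (V ⊗[k] W) (tensorMul k V W B (x ⊗ₜ y)) =
      tensorMul k V W B' (φ.toLinearMap.lTensor V x ⊗ₜ φ.toLinearMap.lTensor W y) := by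
  induction x using TensorProduct.induction_on with
  | zero => simp
  | add x x' hx hx' => simp only [TensorProduct.add_tmul, map_add, hx, hx']
  | tmul v a =>
    induction y using TensorProduct.induction_on with
    | zero => simp
    | add y y' hy hy' => simp only [TensorProduct.tmul_add, map_add, hy, hy']
    | tmul w b => simp

theorem assoc_tensorMul {V W : Type*} [AddCommGroup V] [Module k V] [AddCommGroup W]
    [Module k W] (p : V ⊗[k] A) (q : W ⊗[k] A) (a b : A) :
    TensorProduct.assoc k (V ⊗[k] W) A A (tensorMul k V W A (p ⊗ₜ q) ⊗ₜ (a * b)) =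
      tensorMul k V W (A ⊗[k] A) (TensorProduct.assoc k V A A (p ⊗ₜ a) ⊗ₜ
        TensorProduct.assoc k W A A (q ⊗ₜ b)) := by
  induction p using TensorProduct.induction_on with
  | zero => simp
  | add x x' hx hx' => simp only [TensorProduct.add_tmul, map_add, hx, hx']
  | tmul v a' =>
    induction q using TensorProduct.induction_on with
    | zero => simp
    | add y y' hy hy' => simp only [TensorProduct.tmul_add, TensorProduct.add_tmul, map_add, hy, hy']
    | tmul w b' => simp

theorem assoc_tensorCoact {V W : Type*} [AddCommGroup V] [Module k V] [AddCommGroup W]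
    [Module k W] (ρ : V →ₗ[k] V ⊗[k] A) (σ : W →ₗ[k] W ⊗[k] A) (x : V ⊗[k] A) (y : W ⊗[k] A) :
    TensorProduct.assoc k (V ⊗[k] W) A A
        ((tensorCoact ρ σ).rTensor A (tensorMul k V W A (x ⊗ₜ y))) =
      tensorMul k V W (A ⊗[k] A) (TensorProduct.assoc k V A A (ρ.rTensor A x) ⊗ₜ
        TensorProduct.assoc k W A A (σ.rTensor A y)) := by
  induction x using TensorProduct.induction_on with
  | zero => simp
  | add x x' hx hx' => simp only [TensorProduct.add_tmul, map_add, hx, hx']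
  | tmul v a =>
    induction y using TensorProduct.induction_on with
    | zero => simp
    | add y y' hy hy' => simp only [TensorProduct.tmul_add, map_add, hy, hy']
    | tmul w b => simp [tensorCoact, assoc_tensorMul]

/-- The tensor product of representations. -/
noncomputable def tensor (X Y : FinRep k A) : FinRep k A where
  V := X.V ⊗ Y.V
  ρ := tensorCoact X.ρ Y.ρ
  coassoc v := by
    change X.V ⊗[k] Y.V at v
    change TensorProduct.assoc k (X.V ⊗[k] Y.V) A A ((tensorCoact X.ρ Y.ρ).rTensor A (tensorCoact X.ρ Y.ρ v)) =
      (CoalgebraStruct.comul (R := k) (A := A)).lTensor (X.V ⊗[k] Y.V) (tensorCoact X.ρ Y.ρ v)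
    induction v using TensorProduct.induction_on with
    | zero => simp only [map_zero]
    | add v w hv hw => simp only [map_add, hv, hw]
    | tmul v w =>
      have h := lTensor_tensorMul (Bialgebra.comulAlgHom k A) (X.ρ v) (Y.ρ w)
      have h' := assoc_tensorCoact X.ρ Y.ρ (X.ρ v) (Y.ρ w)
      rw [X.coassoc, Y.coassoc] at h'
      exact h'.trans h.symm
  counit v := by
    change X.V ⊗[k] Y.V at v
    change (CoalgebraStruct.counit (R := k) (A := A)).lTensor (X.V ⊗[k] Y.V) (tensorCoact X.ρ Y.ρ v) =
      v ⊗ₜ[k] (1 : k)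
    induction v using TensorProduct.induction_on with
    | zero => simp only [map_zero, TensorProduct.zero_tmul]
    | add v w hv hw => simp only [map_add, hv, hw, TensorProduct.add_tmul]
    | tmul v w =>
      have h := lTensor_tensorMul (Bialgebra.counitAlgHom k A) (X.ρ v) (Y.ρ w)
      refine h.trans ?_
      change tensorMul k X.V Y.V k
        ((CoalgebraStruct.counit (R := k) (A := A)).lTensor X.V (X.ρ v) ⊗ₜ
          (CoalgebraStruct.counit (R := k) (A := A)).lTensor Y.V (Y.ρ w)) = _
      rw [X.counit, Y.counit, tensorMul_tmul, mul_one]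

/-- The trivial representation on `k`. -/
noncomputable def unit : FinRep k A where
  V := 𝟙_ (FGModuleCat k)
  ρ := (TensorProduct.mk k k A).flip 1
  coassoc v := by
    change k at v
    change TensorProduct.assoc k k A A (((TensorProduct.mk k k A).flip 1).rTensor A (v ⊗ₜ 1)) =
      (CoalgebraStruct.comul (R := k) (A := A)).lTensor k (v ⊗ₜ 1)
    simp [Algebra.TensorProduct.one_def]
  counit v := by
    change k at v
    change (CoalgebraStruct.counit (R := k) (A := A)).lTensor k (v ⊗ₜ 1) = v ⊗ₜ[k] (1 : k)
    simp

theorem rTensor_map_tensorMul {V V' W W' : Type*} [AddCommGroup V] [Module k V] [AddCommGroup W]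
    [Module k W] [AddCommGroup V'] [Module k V'] [AddCommGroup W'] [Module k W']
    (f : V →ₗ[k] V') (g : W →ₗ[k] W') (x : V ⊗[k] A) (y : W ⊗[k] A) :
    tensorMul k V' W' A (f.rTensor A x ⊗ₜ g.rTensor A y) =
      (TensorProduct.map f g).rTensor A (tensorMul k V W A (x ⊗ₜ y)) := by
  induction x using TensorProduct.induction_on with
  | zero => simp
  | add x x' hx hx' => simp only [TensorProduct.add_tmul, map_add, hx, hx']
  | tmul v a =>
    induction y using TensorProduct.induction_on with
    | zero => simp
    | add y y' hy hy' => simp only [TensorProduct.tmul_add, map_add, hy, hy']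
    | tmul w b => simp

theorem tensorCoact_map {V V' W W' : Type*} [AddCommGroup V] [Module k V] [AddCommGroup W]
    [Module k W] [AddCommGroup V'] [Module k V'] [AddCommGroup W'] [Module k W']
    {ρ : V →ₗ[k] V ⊗[k] A} {σ : W →ₗ[k] W ⊗[k] A} {ρ' : V' →ₗ[k] V' ⊗[k] A}
    {σ' : W' →ₗ[k] W' ⊗[k] A} {f : V →ₗ[k] V'} {g : W →ₗ[k] W'}
    (hf : ∀ v, ρ' (f v) = f.rTensor A (ρ v)) (hg : ∀ w, σ' (g w) = g.rTensor A (σ w))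
    (v : V ⊗[k] W) :
    tensorCoact ρ' σ' (TensorProduct.map f g v) =
      (TensorProduct.map f g).rTensor A (tensorCoact ρ σ v) := by
  induction v using TensorProduct.induction_on with
  | zero => simp only [map_zero]
  | add v w hv hw => simp only [map_add, hv, hw]
  | tmul v w =>
    have h := rTensor_map_tensorMul f g (ρ v) (σ w)
    rw [← hf, ← hg] at h
    exact h

theorem assoc_tensorMul_tensorMul {V W T : Type*} [AddCommGroup V] [Module k V] [AddCommGroup W]
    [Module k W] [AddCommGroup T] [Module k T] (x : V ⊗[k] A) (y : W ⊗[k] A) (z : T ⊗[k] A) :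
    tensorMul k V (W ⊗[k] T) A (x ⊗ₜ tensorMul k W T A (y ⊗ₜ z)) =
      (TensorProduct.assoc k V W T).toLinearMap.rTensor A
        (tensorMul k (V ⊗[k] W) T A (tensorMul k V W A (x ⊗ₜ y) ⊗ₜ z)) := by
  induction x using TensorProduct.induction_on with
  | zero => simp
  | add x x' hx hx' => simp only [TensorProduct.add_tmul, map_add, hx, hx']
  | tmul v a =>
    induction y using TensorProduct.induction_on with
    | zero => simp
    | add y y' hy hy' =>
      simp only [TensorProduct.add_tmul, TensorProduct.tmul_add, map_add, hy, hy']
    | tmul w b =>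
      induction z using TensorProduct.induction_on with
      | zero => simp
      | add y y' hy hy' => simp only [TensorProduct.tmul_add, map_add, hy, hy']
      | tmul t c => simp [mul_assoc]

theorem tensorCoact_assoc {V W T : Type*} [AddCommGroup V] [Module k V] [AddCommGroup W]
    [Module k W] [AddCommGroup T] [Module k T] (ρ : V →ₗ[k] V ⊗[k] A) (σ : W →ₗ[k] W ⊗[k] A)
    (τ : T →ₗ[k] T ⊗[k] A) (v : (V ⊗[k] W) ⊗[k] T) :
    tensorCoact ρ (tensorCoact σ τ) (TensorProduct.assoc k V W T v) =
      (TensorProduct.assoc k V W T).toLinearMap.rTensor A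
        (tensorCoact (tensorCoact ρ σ) τ v) := by
  induction v using TensorProduct.induction_on with
  | zero => simp only [map_zero]
  | add v w hv hw => simp only [map_add, hv, hw]
  | tmul v z =>
    induction v using TensorProduct.induction_on with
    | zero => simp only [map_zero, TensorProduct.zero_tmul]
    | add v w hv hw => simp only [map_add, hv, hw, TensorProduct.add_tmul]
    | tmul x y => exact assoc_tensorMul_tensorMul (ρ x) (σ y) (τ z)

theorem lid_tensorMul {V : Type*} [AddCommGroup V] [Module k V] (a : k) (x : V ⊗[k] A) :
    (TensorProduct.lid k V).toLinearMap.rTensor A (tensorMul k k V A ((a ⊗ₜ 1) ⊗ₜ x)) = a • x := by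
  induction x using TensorProduct.induction_on with
  | zero => simp
  | add x x' hx hx' => simp only [TensorProduct.tmul_add, map_add, smul_add, hx, hx']
  | tmul v b => simp [TensorProduct.smul_tmul']

theorem rid_tensorMul {V : Type*} [AddCommGroup V] [Module k V] (a : k) (x : V ⊗[k] A) :
    (TensorProduct.rid k V).toLinearMap.rTensor A (tensorMul k V k A (x ⊗ₜ (a ⊗ₜ 1))) = a • x := by
  induction x using TensorProduct.induction_on with
  | zero => simp
  | add x x' hx hx' => simp only [TensorProduct.add_tmul, map_add, smul_add, hx, hx']
  | tmul v b => simp [TensorProduct.smul_tmul']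

theorem tensorCoact_lid {V : Type*} [AddCommGroup V] [Module k V] (ρ : V →ₗ[k] V ⊗[k] A)
    (v : k ⊗[k] V) :
    ρ (TensorProduct.lid k V v) = (TensorProduct.lid k V).toLinearMap.rTensor A
      (tensorCoact ((TensorProduct.mk k k A).flip 1) ρ v) := by
  induction v using TensorProduct.induction_on with
  | zero => simp only [map_zero]
  | add v w hv hw => simp only [map_add, hv, hw]
  | tmul a x =>
    rw [TensorProduct.lid_tmul, map_smul]
    exact (lid_tensorMul a (ρ x)).symm

theorem tensorCoact_rid {V : Type*} [AddCommGroup V] [Module k V] (ρ : V →ₗ[k] V ⊗[k] A)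
    (v : V ⊗[k] k) :
    ρ (TensorProduct.rid k V v) = (TensorProduct.rid k V).toLinearMap.rTensor A
      (tensorCoact ρ ((TensorProduct.mk k k A).flip 1) v) := by
  induction v using TensorProduct.induction_on with
  | zero => simp only [map_zero]
  | add v w hv hw => simp only [map_add, hv, hw]
  | tmul x a =>
    rw [TensorProduct.rid_tmul, map_smul]
    exact (rid_tensorMul a (ρ x)).symm

theorem comm_tensorMul {V W : Type*} [AddCommGroup V] [Module k V] [AddCommGroup W]
    [Module k W] (x : V ⊗[k] A) (y : W ⊗[k] A) :
    tensorMul k W V A (y ⊗ₜ x) =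
      (TensorProduct.comm k V W).toLinearMap.rTensor A (tensorMul k V W A (x ⊗ₜ y)) := by
  induction x using TensorProduct.induction_on with
  | zero => simp
  | add x x' hx hx' => simp only [TensorProduct.add_tmul, TensorProduct.tmul_add, map_add, hx, hx']
  | tmul v a =>
    induction y using TensorProduct.induction_on with
    | zero => simp
    | add y y' hy hy' =>
      simp only [TensorProduct.add_tmul, TensorProduct.tmul_add, map_add, hy, hy']
    | tmul w b => simp [mul_comm]

theorem tensorCoact_comm {V W : Type*} [AddCommGroup V] [Module k V] [AddCommGroup W]
    [Module k W] (ρ : V →ₗ[k] V ⊗[k] A) (σ : W →ₗ[k] W ⊗[k] A) (v : V ⊗[k] W) :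
    tensorCoact σ ρ (TensorProduct.comm k V W v) =
      (TensorProduct.comm k V W).toLinearMap.rTensor A (tensorCoact ρ σ v) := by
  induction v using TensorProduct.induction_on with
  | zero => simp only [map_zero]
  | add v w hv hw => simp only [map_add, hv, hw]
  | tmul x y => exact comm_tensorMul (ρ x) (σ y)

noncomputable instance : MonoidalCategoryStruct (FinRep k A) where
  tensorObj := tensor
  tensorUnit := unit
  whiskerLeft X _ _ f := homMk (X.V ◁ f.1) (tensorCoact_map (𝟙 X : X ⟶ X).2 f.2)
  whiskerRight f Y := homMk (f.1 ▷ Y.V) (tensorCoact_map f.2 (𝟙 Y : Y ⟶ Y).2)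
  tensorHom f g := homMk (f.1 ⊗ₘ g.1) (tensorCoact_map f.2 g.2)
  associator X Y Z := isoMk (α_ X.V Y.V Z.V) (tensorCoact_assoc X.ρ Y.ρ Z.ρ)
  leftUnitor X := isoMk (λ_ X.V) (tensorCoact_lid X.ρ)
  rightUnitor X := isoMk (ρ_ X.V) (tensorCoact_rid X.ρ)

/-- The constraints making `forget` a strict tensor functor. -/
noncomputable def forgetData : Monoidal.InducingFunctorData (forget k A) where
  μIso _ _ := Iso.refl _
  εIso := Iso.refl _
  whiskerLeft_eq X _ _ f := (Category.id_comp _).symm.trans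
    (congrArg _ (Category.comp_id (X.V ◁ f.1)).symm)
  whiskerRight_eq f Y := (Category.id_comp _).symm.trans
    (congrArg _ (Category.comp_id (f.1 ▷ Y.V)).symm)
  tensorHom_eq f g := (Category.id_comp _).symm.trans
    (congrArg _ (Category.comp_id (f.1 ⊗ₘ g.1)).symm)
  associator_eq X Y Z := by
    change (α_ X.V Y.V Z.V).hom = (𝟙 _ ≫ (𝟙 (tensorObj X.V Y.V) ⊗ₘ 𝟙 Z.V)) ≫
      (α_ X.V Y.V Z.V).hom ≫ (𝟙 X.V ⊗ₘ 𝟙 (tensorObj Y.V Z.V)) ≫ 𝟙 _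
    rw [id_tensorHom_id, id_tensorHom_id, Category.id_comp, Category.id_comp, Category.comp_id]
    exact (Category.comp_id _).symm
  leftUnitor_eq X := by
    change (λ_ X.V).hom = (𝟙 _ ≫ (𝟙 (𝟙_ (FGModuleCat k)) ⊗ₘ 𝟙 X.V)) ≫ (λ_ X.V).hom
    rw [id_tensorHom_id, Category.id_comp]
    exact (Category.id_comp _).symm
  rightUnitor_eq X := by
    change (ρ_ X.V).hom = (𝟙 _ ≫ (𝟙 X.V ⊗ₘ 𝟙 (𝟙_ (FGModuleCat k)))) ≫ (ρ_ X.V).hom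
    rw [id_tensorHom_id, Category.id_comp]
    exact (Category.id_comp _).symm

noncomputable instance : MonoidalCategory (FinRep k A) :=
  Monoidal.induced (forget k A) forgetData

noncomputable instance : (forget k A).Monoidal :=
  Monoidal.fromInducedMonoidal (forget k A) forgetData

/-- The braiding is the usual `v ⊗ w ↦ w ⊗ v`. -/
noncomputable instance : BraidedCategory (FinRep k A) :=
  .ofFaithful (forget k A) (fun X Y => isoMk (β_ X.V Y.V) (tensorCoact_comm X.ρ Y.ρ)) fun _ _ =>
    (Category.id_comp _).trans (Category.comp_id _).symm

noncomputable instance : (forget k A).Braided where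
  braided _ _ := (Category.id_comp _).trans (Category.comp_id _).symm

noncomputable instance : SymmetricCategory (FinRep k A) :=
  .ofFaithful (forget k A)

end FinRep

end Rep

/-! ### Linear algebra over an ultraproduct of fields -/

/-! The engine is Łoś's principle: for an ultrafilter, "for almost every i" commutes with negation
and with quantifiers over families (`UProd.eventually_exists_iff`, `UProd.eventually_forall_iff`).
Properties expressed by equations and by existence of elements or morphisms therefore pass between
almost all members of a family and its ultraproduct. The bound on dimensions is used where finite
sums need a length independent of i: `UProd.exists_frame` gives n vectors and n coordinate functions
for almost every i. Hence the comparison map from ∏V_i ⊗ ∏W_i to ∏(V_i ⊗ W_i), which is always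
injective (`UProd.tensorMap_injective`), is bijective when the dimensions of the V_i are bounded,
and every linear map on ∏V_i is then an ultraproduct of linear maps (`UProd.exists_mapₗ_eq`).

For (1), the comparison isomorphism composed with the constraints of the ω_i is the tensor structure
of ω, whose coherence is checked on pure tensors of classes. Kernels, cokernels, biproducts and
duals are formed componentwise. They stay in the restricted ultraproduct because exactness of ω_i
bounds kernels and cokernels, additivity bounds biproducts, and monoidality gives a dual the same
dimension. A monomorphism [f_i] has f_i mono for almost every i, so it is a kernel because almost
every f_i is; dually for epimorphisms. Exactness and faithfulness of ω are again componentwise.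

For (2), no reconstruction theorem is used; the Hopf algebra is written down. The ring ∏A_i is not
obviously a coalgebra, since the componentwise comultiplication lands in ∏(A_i ⊗ A_i). But if x_i
are coefficient matrices of comodules, of a size independent of i, then Δx_{jl} = ∑ x_{jm} ⊗ x_{ml}
has a bounded number of terms. So the span B of the classes of such coefficients carries a
comultiplication (`UProd.CoeffAlg.exists_comul`); Kronecker products and transposed antipodes of
coefficient matrices are coefficient matrices, which makes B a Hopf algebra. Since ∏V_i ⊗ B embeds
in ∏(V_i ⊗ A_i), the componentwise coactions define a B-comodule structure on ∏V_i
(`RepProd.exists_coact`), and compatibility of a linear map with coactions is a componentwise matter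
(`RepProd.mapₗ_coact_iff`), whence full faithfulness. A coefficient matrix over B lifts to
coefficient matrices over the A_i (`RepProd.exists_isComatrix_lift`), whence essential surjectivity.
-/

/-- A vector space of dimension at most `n` has a spanning family of `n` vectors with linear
coordinate functions. -/
theorem exists_frame {K V : Type*} [Field K] [AddCommGroup V] [Module K V] [Module.Finite K V]
    {n : ℕ} (h : Module.finrank K V ≤ n) :
    ∃ (e : Fin n → V) (c : Fin n → V →ₗ[K] K), ∀ x, ∑ j, c j x • e j = x := by
  let b := Module.finBasis K V
  -- A basis and its coordinate functions, padded with zeros up to length n, so that the index set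
  -- does not depend on the actual dimension.
  refine ⟨fun j => if hj : (j : ℕ) < Module.finrank K V then b ⟨j, hj⟩ else 0,
    fun j => if hj : (j : ℕ) < Module.finrank K V then b.coord ⟨j, hj⟩ else 0, fun x => ?_⟩
  conv_rhs => rw [← b.sum_repr x]
  symm
  refine Finset.sum_of_injOn (Fin.castLE h) (Fin.castLE_injective h).injOn
    (fun _ _ => Finset.mem_coe.2 (Finset.mem_univ _)) ?_ ?_
  · intro j _ hj
    have : ¬ (j : ℕ) < Module.finrank K V := fun hj' => hj ⟨⟨j, hj'⟩, by simp, rfl⟩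
    simp [this]
  · intro j _
    simp

/-- Independence provides a linear map g carrying x_l to the l-th standard vector; applying the j-th
coordinate of g to the left factor isolates y_j. -/
theorem LinearIndependent.eq_zero_of_sum_tmul_eq_zero {K V W J : Type*} [Field K]
    [AddCommGroup V] [Module K V] [AddCommGroup W] [Module K W] [Fintype J] {x : J → V}
    (hx : LinearIndependent K x) {y : J → W} (h : ∑ j, x j ⊗ₜ[K] y j = 0) (j : J) : y j = 0 := by
  classical
  obtain ⟨g, hg⟩ := LinearMap.exists_leftInverse_of_injective
    (Finsupp.linearCombination K x) (LinearMap.ker_eq_bot.2 hx)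
  have hgx : ∀ l, g (x l) = Finsupp.single l 1 := fun l => by
    simpa using LinearMap.congr_fun hg (Finsupp.single l 1)
  have := congrArg (fun t => TensorProduct.lid K W ((Finsupp.lapply j ∘ₗ g).rTensor W t)) h
  simpa [hgx, Finsupp.single_apply] using this

namespace UProd

variable {I : Type w₀} {U : Ultrafilter I}

theorem mk_surjective {E : I → Type*} (x : UProd U E) : ∃ y, mk U y = x :=
  ind (p := fun x => ∃ y, mk U y = x) (fun y => ⟨y, rfl⟩) x

theorem exists_mk {J : Type*} {E : I → Type*} (x : J → UProd U E) :
    ∃ y : J → ∀ i, E i, ∀ j, mk U (y j) = x j :=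
  ⟨fun j => (mk_surjective (x j)).choose, fun j => (mk_surjective (x j)).choose_spec⟩

/-- Łoś's principle for ∃: pick a witness where there is one and anything elsewhere, which is why
the sets must be nonempty. -/
theorem eventually_exists_iff {E : I → Type*} [∀ i, Nonempty (E i)] {p : ∀ i, E i → Prop} :
    (∀ᶠ i in (U : Filter I), ∃ x, p i x) ↔ ∃ x : ∀ i, E i, ∀ᶠ i in (U : Filter I), p i (x i) := by
  classical
  refine ⟨fun h => ⟨fun i => if hi : ∃ x, p i x then hi.choose else Classical.arbitrary _,
    h.mono fun i hi => ?_⟩, fun ⟨x, hx⟩ => hx.mono fun i hi => ⟨x i, hi⟩⟩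
  simp only [dif_pos hi]
  exact hi.choose_spec

/-- Łoś's principle for ∀. This direction needs an ultrafilter: if the property fails to hold almost
everywhere, counterexamples exist almost everywhere and assemble into one family. -/
theorem eventually_forall_iff {E : I → Type*} [∀ i, Nonempty (E i)] {p : ∀ i, E i → Prop} :
    (∀ᶠ i in (U : Filter I), ∀ x, p i x) ↔ ∀ x : ∀ i, E i, ∀ᶠ i in (U : Filter I), p i (x i) := by
  refine ⟨fun h x => h.mono fun i hi => hi _, fun h => ?_⟩
  by_contra hn
  rw [← Ultrafilter.eventually_not] at hn
  obtain ⟨x, hx⟩ := eventually_exists_iff.1 (hn.mono fun i hi => not_forall.1 hi)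
  obtain ⟨i, h1, h2⟩ := ((h x).and hx).exists
  exact h2 h1

variable {k : I → Type*} [∀ i, Field (k i)]
  {V : I → Type*} [∀ i, AddCommGroup (V i)] [∀ i, Module (k i) (V i)]
  {W : I → Type*} [∀ i, AddCommGroup (W i)] [∀ i, Module (k i) (W i)]

/-- Nontrivial relations for almost every i would assemble into a relation between the classes. Its
coefficients then vanish, and as J is finite they vanish simultaneously for almost every i. -/
theorem linearIndependent_of_mk {J : Type*} [Fintype J] {x : J → ∀ i, V i}
    (h : LinearIndependent (UProd U k) fun j => mk U (x j)) :
    ∀ᶠ i in (U : Filter I), LinearIndependent (k i) fun j => x j i := by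
  simp only [Fintype.linearIndependent_iff] at h ⊢
  rw [eventually_forall_iff]
  intro a
  by_contra hn
  rw [← Ultrafilter.eventually_not] at hn
  have h1 : ∀ j, ∀ᶠ i in (U : Filter I), a i j = 0 := fun j => by
    refine mk_eq_mk.1 (h (fun j => mk U fun i => a i j) ?_ j)
    simp only [mk_smul, mk_sum]
    exact mk_eq_mk.2 (hn.mono fun i hi => (Classical.not_imp.1 hi).1)
  obtain ⟨i, h2, h3⟩ := ((Filter.eventually_all.2 h1).and hn).exists
  exact h3 fun _ => h2

/-- The ultraproduct of linear maps. -/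
def mapₗ (U : Ultrafilter I) (f : ∀ i, V i →ₗ[k i] W i) :
    UProd U V →ₗ[UProd U k] UProd U W where
  toFun := map fun i => f i
  map_add' := ind fun _ => ind fun _ => mk_congr fun _ => map_add _ _ _
  map_smul' := ind fun _ => ind fun _ => mk_congr fun _ => map_smul _ _ _

@[simp] theorem mapₗ_mk (f : ∀ i, V i →ₗ[k i] W i) (v : ∀ i, V i) :
    mapₗ U f (mk U v) = mk U fun i => f i (v i) := rfl

theorem mapₗ_eq_iff {f g : ∀ i, V i →ₗ[k i] W i} :
    mapₗ U f = mapₗ U g ↔ ∀ᶠ i in (U : Filter I), f i = g i := by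
  simp only [LinearMap.ext_iff]
  rw [eventually_forall_iff]
  exact ⟨fun h x => mk_eq_mk.1 (h (mk U x)), fun h => ind fun x => mk_eq_mk.2 (h x)⟩

/-- The number n of vectors is the same for all i. This is what lets expansions in the V_i become
finite sums in the ultraproduct. -/
theorem exists_frame [∀ i, Module.Finite (k i) (V i)] {n : ℕ}
    (h : ∀ᶠ i in (U : Filter I), Module.finrank (k i) (V i) ≤ n) :
    ∃ (e : ∀ i, Fin n → V i) (c : ∀ i, Fin n → V i →ₗ[k i] k i),
      ∀ᶠ i in (U : Filter I), ∀ x, ∑ j, c i j x • e i j = x := by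
  obtain ⟨e, he⟩ := eventually_exists_iff.1 (h.mono fun i hi => _root_.exists_frame hi)
  obtain ⟨c, hc⟩ := eventually_exists_iff.1 he
  exact ⟨e, c, hc⟩

/-- φ is determined by its values on the n classes of frame vectors; representatives w_j of these
values give f_i = ∑ c_j(·) w_j. -/
theorem exists_mapₗ_eq [∀ i, Module.Finite (k i) (V i)] {n : ℕ}
    (h : ∀ᶠ i in (U : Filter I), Module.finrank (k i) (V i) ≤ n)
    (φ : UProd U V →ₗ[UProd U k] UProd U W) : ∃ f : ∀ i, V i →ₗ[k i] W i, mapₗ U f = φ := by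
  obtain ⟨e, c, hc⟩ := exists_frame h
  obtain ⟨w, hw⟩ := exists_mk fun j => φ (mk U fun i => e i j)
  refine ⟨fun i => ∑ j, (c i j).smulRight (w j i), LinearMap.ext (ind fun x => ?_)⟩
  have hx : mk U x = ∑ j, (mk U fun i => c i j (x i)) • (mk U fun i => e i j) := by
    simp only [mk_smul, mk_sum]
    exact mk_eq_mk.2 (hc.mono fun i hi => (hi (x i)).symm)
  calc mapₗ U _ (mk U x) = ∑ j, (mk U fun i => c i j (x i)) • mk U (w j) := by
        simp only [mapₗ_mk, mk_smul, mk_sum]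
        exact mk_congr fun i => by simp
    _ = φ (mk U x) := by rw [hx, map_sum]; simp only [map_smul, hw]

/-- The ultraproduct of linear equivalences. -/
noncomputable def mapEquiv (U : Ultrafilter I) (e : ∀ i, V i ≃ₗ[k i] W i) :
    UProd U V ≃ₗ[UProd U k] UProd U W :=
  { mapₗ U fun i => (e i).toLinearMap with
    invFun := mapₗ U fun i => (e i).symm.toLinearMap
    left_inv := ind fun _ => mk_congr fun i => (e i).symm_apply_apply _
    right_inv := ind fun _ => mk_congr fun i => (e i).apply_symm_apply _ }

/-- The comparison map `∏_U V i ⊗ ∏_U W i → ∏_U (V i ⊗ W i)`. -/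
noncomputable def tensorMap (U : Ultrafilter I) (k : I → Type*) [∀ i, Field (k i)]
    (V : I → Type*) [∀ i, AddCommGroup (V i)] [∀ i, Module (k i) (V i)]
    (W : I → Type*) [∀ i, AddCommGroup (W i)] [∀ i, Module (k i) (W i)] :
    UProd U V ⊗[UProd U k] UProd U W →ₗ[UProd U k] UProd U fun i => V i ⊗[k i] W i :=
  TensorProduct.lift (LinearMap.mk₂ _ (map₂ fun i v w => v ⊗ₜ[k i] w)
    (ind fun _ => ind fun _ => ind fun _ => mk_congr fun _ => TensorProduct.add_tmul _ _ _)
    (ind fun _ => ind fun _ => ind fun _ => mk_congr fun _ => TensorProduct.smul_tmul' _ _ _)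
    (ind fun _ => ind fun _ => ind fun _ => mk_congr fun _ => TensorProduct.tmul_add _ _ _)
    (ind fun _ => ind fun _ => ind fun _ => mk_congr fun _ => TensorProduct.tmul_smul _ _ _))

@[simp] theorem tensorMap_mk (v : ∀ i, V i) (w : ∀ i, W i) :
    tensorMap U k V W (mk U v ⊗ₜ mk U w) = mk U fun i => v i ⊗ₜ[k i] w i := rfl

/-- No bound is needed: one tensor involves finitely many vectors. With the left factors
independent, so are their representatives for almost every i, and a vanishing image forces the right
factors to vanish there. -/
theorem tensorMap_injective : Function.Injective (tensorMap U k V W) := by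
  rw [← LinearMap.ker_eq_bot, LinearMap.ker_eq_bot']
  intro t ht
  obtain ⟨n, x, y, hx, rfl⟩ : ∃ (n : ℕ) (x : Fin n → UProd U V) (y : Fin n → UProd U W),
      LinearIndependent (UProd U k) x ∧ t = ∑ j, x j ⊗ₜ y j := by
    -- Expanding the left factor in a basis makes the left vectors independent.
    let b := Module.Basis.ofVectorSpace (UProd U k) (UProd U V)
    obtain ⟨c, hc⟩ := TensorProduct.eq_repr_basis_left b t
    let e := c.support.equivFin
    refine ⟨_, fun j => b (e.symm j), fun j => c (e.symm j),
      b.linearIndependent.comp _ (Subtype.val_injective.comp e.symm.injective), ?_⟩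
    rw [← hc, Finsupp.sum, ← Finset.sum_coe_sort, ← e.symm.sum_comp]
  obtain ⟨x, rfl⟩ : ∃ x' : Fin n → ∀ i, V i, x = fun j => mk U (x' j) := by
    obtain ⟨x', h⟩ := exists_mk x
    exact ⟨x', funext fun j => (h j).symm⟩
  obtain ⟨y, rfl⟩ : ∃ y' : Fin n → ∀ i, W i, y = fun j => mk U (y' j) := by
    obtain ⟨y', h⟩ := exists_mk y
    exact ⟨y', funext fun j => (h j).symm⟩
  simp only [map_sum, tensorMap_mk, mk_sum] at ht
  have hy : ∀ᶠ i in (U : Filter I), ∀ j, y j i = 0 := by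
    refine ((linearIndependent_of_mk hx).and (mk_eq_mk.1 ht)).mono fun i hi j => ?_
    exact hi.1.eq_zero_of_sum_tmul_eq_zero hi.2 j
  refine Finset.sum_eq_zero fun j _ => ?_
  have : mk U (y j) = 0 := mk_eq_mk.2 (hy.mono fun i hi => hi j)
  simp only [this, TensorProduct.tmul_zero]

/-- Contracting with the coordinate functions of a frame writes every t_i as a sum of n pure
tensors, with n independent of i. A bound on the left factor suffices. -/
theorem tensorMap_surjective [∀ i, Module.Finite (k i) (V i)] {n : ℕ}
    (h : ∀ᶠ i in (U : Filter I), Module.finrank (k i) (V i) ≤ n) :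
    Function.Surjective (tensorMap U k V W) := by
  obtain ⟨e, c, hc⟩ := exists_frame h
  refine ind fun t => ⟨∑ j, (mk U fun i => e i j) ⊗ₜ
    mk U fun i => TensorProduct.lid (k i) (W i) ((c i j).rTensor (W i) (t i)), ?_⟩
  simp only [map_sum, tensorMap_mk, mk_sum]
  refine mk_eq_mk.2 (hc.mono fun i hi => ?_)
  generalize t i = s
  induction s using TensorProduct.induction_on with
  | zero => simp
  | add s s' hs hs' => simp only [map_add, TensorProduct.tmul_add, Finset.sum_add_distrib, hs, hs']
  | tmul v w =>
    conv_rhs => rw [← hi v]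
    simp [TensorProduct.sum_tmul, TensorProduct.smul_tmul]

end UProd

/-! ### The tensor structure of the fibre functor -/

namespace ResProd

variable {I : Type u} {U : Ultrafilter I} {k : I → Type u} [∀ i, Field (k i)]
  {C : I → Type u₁} [∀ i, Category.{u} (C i)] {ω : ∀ i, C i ⥤ FGModuleCat.{u} (k i)}

/-- The morphism `[f i]` of the restricted ultraproduct. -/
def homMk {X Y : ResProd U ω} (f : ∀ i, X.obj.obj i ⟶ Y.obj.obj i) : X ⟶ Y :=
  ObjectProperty.homMk (UProdCat.homMk f)

theorem homMk_surjective {X Y : ResProd U ω} (f : X ⟶ Y) : ∃ g, homMk g = f := by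
  obtain ⟨g, hg⟩ := UProd.mk_surjective f.hom
  exact ⟨g, ObjectProperty.hom_ext _ hg⟩

theorem homMk_eq_iff {X Y : ResProd U ω} {f g : ∀ i, X.obj.obj i ⟶ Y.obj.obj i} :
    homMk f = homMk g ↔ ∀ᶠ i in (U : Filter I), f i = g i :=
  ⟨fun h => UProd.mk_eq_mk.1 (congrArg InducedCategory.Hom.hom h),
    fun h => ObjectProperty.hom_ext _ (UProd.mk_eq_mk.2 h)⟩

theorem homMk_comp {X Y Z : ResProd U ω} (f : ∀ i, X.obj.obj i ⟶ Y.obj.obj i)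
    (g : ∀ i, Y.obj.obj i ⟶ Z.obj.obj i) :
    homMk f ≫ homMk g = homMk (ω := ω) fun i => f i ≫ g i := rfl

variable [∀ i, MonoidalCategory (C i)] [∀ i, (ω i).Monoidal]

/-- The unit constraint of the functor `resFunctor`. -/
noncomputable def resEpsilon : UProd U k ≃ₗ[UProd U k] UProd U fun i => (ω i).obj (𝟙_ (C i)) :=
  UProd.mapEquiv U fun i => FGModuleCat.isoToLinearEquiv (Functor.Monoidal.εIso (ω i))

/-- The tensor constraint of the functor `resFunctor`. -/
noncomputable def resMu (X Y : ResProd U ω) :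
    (UProd U fun i => (ω i).obj (X.obj.obj i)) ⊗[UProd U k]
        (UProd U fun i => (ω i).obj (Y.obj.obj i)) ≃ₗ[UProd U k]
      UProd U fun i => (ω i).obj (X.obj.obj i ⊗ Y.obj.obj i) :=
  (LinearEquiv.ofBijective (UProd.tensorMap U k _ _) ⟨UProd.tensorMap_injective,
      UProd.tensorMap_surjective X.property.choose_spec⟩).trans
    (UProd.mapEquiv U fun i => FGModuleCat.isoToLinearEquiv
      (Functor.Monoidal.μIso (ω i) (X.obj.obj i) (Y.obj.obj i)))

/-- The tensor structure of the functor `resFunctor`. -/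
noncomputable def resFunctorCore : (resFunctor U ω).CoreMonoidal where
  εIso := (ModuleCat.isFG (UProd U k)).isoMk resEpsilon.toModuleIso
  μIso X Y := (ModuleCat.isFG (UProd U k)).isoMk (resMu X Y).toModuleIso
  -- Each coherence identity is compared on pure tensors of classes, where it is the corresponding
  -- identity for ω_i at each index.
  μIso_hom_natural_left {X Y} f Z := by
    obtain ⟨f, rfl⟩ := homMk_surjective f
    refine FGModuleCat.hom_ext (TensorProduct.ext' (UProd.ind fun v => UProd.ind fun w =>
      UProd.mk_congr fun i => ?_))
    have := Functor.LaxMonoidal.μ_natural_left (ω i) (f i) (Z.obj.obj i)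
    exact LinearMap.congr_fun (congrArg (fun f => f.hom.hom) this) (v i ⊗ₜ[k i] w i)
  μIso_hom_natural_right {X Y} Z f := by
    obtain ⟨f, rfl⟩ := homMk_surjective f
    refine FGModuleCat.hom_ext (TensorProduct.ext' (UProd.ind fun v => UProd.ind fun w =>
      UProd.mk_congr fun i => ?_))
    have := Functor.LaxMonoidal.μ_natural_right (ω i) (Z.obj.obj i) (f i)
    exact LinearMap.congr_fun (congrArg (fun f => f.hom.hom) this) (v i ⊗ₜ[k i] w i)
  associativity X Y Z := by
    refine FGModuleCat.hom_ext (TensorProduct.ext_threefold (UProd.ind fun v => UProd.ind fun w =>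
      UProd.ind fun t => UProd.mk_congr fun i => ?_))
    have := Functor.LaxMonoidal.associativity (ω i) (X.obj.obj i) (Y.obj.obj i) (Z.obj.obj i)
    exact LinearMap.congr_fun (congrArg (fun f => f.hom.hom) this) ((v i ⊗ₜ[k i] w i) ⊗ₜ[k i] t i)
  left_unitality X := by
    refine FGModuleCat.hom_ext (TensorProduct.ext' (UProd.ind fun a => UProd.ind fun v =>
      UProd.mk_congr fun i => ?_))
    have := Functor.LaxMonoidal.left_unitality (ω i) (X.obj.obj i)
    exact LinearMap.congr_fun (congrArg (fun f => f.hom.hom) this) (a i ⊗ₜ[k i] v i)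
  right_unitality X := by
    refine FGModuleCat.hom_ext (TensorProduct.ext' (UProd.ind fun v => UProd.ind fun a =>
      UProd.mk_congr fun i => ?_))
    have := Functor.LaxMonoidal.right_unitality (ω i) (X.obj.obj i)
    exact LinearMap.congr_fun (congrArg (fun f => f.hom.hom) this) (v i ⊗ₜ[k i] a i)

noncomputable instance : (resFunctor U ω).Monoidal := resFunctorCore.toMonoidal

end ResProd

noncomputable instance {I : Type u} {U : Ultrafilter I} {k : I → Type u} [∀ i, Field (k i)]
    {C : I → Type u₁} [∀ i, Category.{u} (C i)] {ω : ∀ i, C i ⥤ FGModuleCat.{u} (k i)}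
    [∀ i, MonoidalCategory (C i)] [∀ i, SymmetricCategory (C i)] [∀ i, (ω i).Braided] :
    (resFunctor U ω).Braided where
  braided X Y := by
    refine FGModuleCat.hom_ext (TensorProduct.ext' (UProd.ind fun v => UProd.ind fun w =>
      UProd.mk_congr fun i => ?_))
    have := Functor.LaxBraided.braided (F := ω i) (X.obj.obj i) (Y.obj.obj i)
    exact LinearMap.congr_fun (congrArg (fun f => f.hom.hom) this) (v i ⊗ₜ[k i] w i)

/-! ### Kernel and cokernel pairs -/

namespace CategoryTheory

section KernelPairs

variable {C : Type*} [Category* C] [HasZeroMorphisms C] {X Y Z : C}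

/-- The morphism `f` is a kernel of `g`. -/
def IsKernelOf (f : X ⟶ Y) (g : Y ⟶ Z) : Prop :=
  ∃ w : f ≫ g = 0, Nonempty (IsLimit (KernelFork.ofι f w))

/-- The morphism `g` is a cokernel of `f`. -/
def IsCokernelOf (f : X ⟶ Y) (g : Y ⟶ Z) : Prop :=
  ∃ w : f ≫ g = 0, Nonempty (IsColimit (CokernelCofork.ofπ g w))

/-- The universal property in elementary form: an equation, cancellation, and existence of
factorizations. In this form it can be transferred by Łoś's principle. -/
theorem isKernelOf_iff {f : X ⟶ Y} {g : Y ⟶ Z} :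
    IsKernelOf f g ↔ f ≫ g = 0 ∧ Mono f ∧
      ∀ (W : C) (h : W ⟶ Y), h ≫ g = 0 → ∃ l, l ≫ f = h := by
  constructor
  · rintro ⟨w, ⟨hf⟩⟩
    exact ⟨w, mono_of_isLimit_fork hf, fun W h hh =>
      ⟨(KernelFork.IsLimit.lift' hf h hh).1, (KernelFork.IsLimit.lift' hf h hh).2⟩⟩
  · rintro ⟨w, hf, hl⟩
    choose l hl using hl
    exact ⟨w, ⟨KernelFork.IsLimit.ofι f w (fun g' hg' => l _ g' hg') (fun g' hg' => hl _ g' hg')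
      fun g' hg' m hm => by rw [← cancel_mono f, hm, hl]⟩⟩

theorem isCokernelOf_iff {f : X ⟶ Y} {g : Y ⟶ Z} :
    IsCokernelOf f g ↔ f ≫ g = 0 ∧ Epi g ∧
      ∀ (W : C) (h : Y ⟶ W), f ≫ h = 0 → ∃ l, g ≫ l = h := by
  constructor
  · rintro ⟨w, ⟨hf⟩⟩
    exact ⟨w, epi_of_isColimit_cofork hf, fun W h hh =>
      ⟨(CokernelCofork.IsColimit.desc' hf h hh).1, (CokernelCofork.IsColimit.desc' hf h hh).2⟩⟩
  · rintro ⟨w, hf, hl⟩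
    choose l hl using hl
    exact ⟨w, ⟨CokernelCofork.IsColimit.ofπ g w (fun g' hg' => l _ g' hg')
      (fun g' hg' => hl _ g' hg') fun g' hg' m hm => by rw [← cancel_epi g, hm, hl]⟩⟩

theorem isKernelOf_kernel_ι (g : Y ⟶ Z) [HasKernel g] : IsKernelOf (kernel.ι g) g :=
  ⟨kernel.condition g, ⟨kernelIsKernel g⟩⟩

theorem isCokernelOf_cokernel_π (f : X ⟶ Y) [HasCokernel f] : IsCokernelOf f (cokernel.π f) :=
  ⟨cokernel.condition f, ⟨cokernelIsCokernel f⟩⟩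

theorem IsKernelOf.hasKernel {f : X ⟶ Y} {g : Y ⟶ Z} (h : IsKernelOf f g) : HasKernel g :=
  ⟨⟨⟨_, h.choose_spec.some⟩⟩⟩

theorem IsCokernelOf.hasCokernel {f : X ⟶ Y} {g : Y ⟶ Z} (h : IsCokernelOf f g) :
    HasCokernel f := ⟨⟨⟨_, h.choose_spec.some⟩⟩⟩

variable {D : Type*} [Category* D] [HasZeroMorphisms D] (F : C ⥤ D) [F.PreservesZeroMorphisms]

theorem IsKernelOf.map [PreservesFiniteLimits F] {f : X ⟶ Y} {g : Y ⟶ Z} (h : IsKernelOf f g) :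
    IsKernelOf (F.map f) (F.map g) :=
  ⟨by rw [← F.map_comp, h.choose, F.map_zero],
    ⟨isLimitForkMapOfIsLimit' F h.choose h.choose_spec.some⟩⟩

theorem IsCokernelOf.map [PreservesFiniteColimits F] {f : X ⟶ Y} {g : Y ⟶ Z}
    (h : IsCokernelOf f g) : IsCokernelOf (F.map f) (F.map g) :=
  ⟨by rw [← F.map_comp, h.choose, F.map_zero],
    ⟨isColimitCoforkMapOfIsColimit' F h.choose h.choose_spec.some⟩⟩

theorem IsKernelOf.preservesLimit {f : X ⟶ Y} {g : Y ⟶ Z} (h : IsKernelOf f g)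
    (h' : IsKernelOf (F.map f) (F.map g)) : PreservesLimit (parallelPair g 0) F :=
  preservesLimit_of_preserves_limit_cone h.choose_spec.some
    ((isLimitMapConeForkEquiv' F h.choose).symm h'.choose_spec.some)

theorem IsCokernelOf.preservesColimit {f : X ⟶ Y} {g : Y ⟶ Z} (h : IsCokernelOf f g)
    (h' : IsCokernelOf (F.map f) (F.map g)) : PreservesColimit (parallelPair f 0) F :=
  preservesColimit_of_preserves_colimit_cocone h.choose_spec.some
    ((isColimitMapCoconeCoforkEquiv' F h.choose).symm h'.choose_spec.some)

end KernelPairs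

theorem Abelian.isKernelOf_of_mono {C : Type*} [Category* C] [Abelian C] {X Y : C} (f : X ⟶ Y)
    [Mono f] : IsKernelOf f (cokernel.π f) :=
  ⟨_, ⟨Abelian.monoIsKernelOfCokernel _ (colimit.isColimit _)⟩⟩

theorem Abelian.isCokernelOf_of_epi {C : Type*} [Category* C] [Abelian C] {X Y : C} (f : X ⟶ Y)
    [Epi f] : IsCokernelOf (kernel.ι f) f :=
  ⟨_, ⟨Abelian.epiIsCokernelOfKernel _ (limit.isLimit _)⟩⟩

end CategoryTheory

/-! ### Kernels and cokernels of finite-dimensional vector spaces -/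

namespace FGModuleCat

variable {K : Type u} [Field K] {X Y Z : FGModuleCat.{u} K}

/-- Elements are morphisms from the line K, so the universal property tested on K gives injectivity
and exactness. Conversely a linear left inverse of f produces the factorizations. -/
theorem isKernelOf_iff {f : X ⟶ Y} {g : Y ⟶ Z} : IsKernelOf f g ↔
    Function.Injective f.hom.hom ∧ Function.Exact f.hom.hom g.hom.hom := by
  rw [CategoryTheory.isKernelOf_iff]
  constructor
  · rintro ⟨w, hf, hl⟩
    have hw : ∀ x, g.hom.hom (f.hom.hom x) = 0 := fun x =>
      LinearMap.congr_fun (congrArg (fun f => f.hom.hom) w) x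
    let s {T : FGModuleCat.{u} K} (x : T) : FGModuleCat.of K K ⟶ T :=
      ObjectProperty.homMk (ModuleCat.ofHom (LinearMap.toSpanSingleton K T x))
    constructor
    · rw [← LinearMap.ker_eq_bot, LinearMap.ker_eq_bot']
      intro x hx
      have h0 : s x = 0 := by
        rw [← cancel_mono f, zero_comp]
        refine FGModuleCat.hom_ext (LinearMap.ext_ring ?_)
        change f.hom.hom ((1 : K) • x) = 0
        rw [one_smul, hx]
      have : (1 : K) • x = 0 := LinearMap.congr_fun (congrArg (fun f => f.hom.hom) h0) (1 : K)
      rwa [one_smul] at this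
    · refine fun y => ⟨fun hy => ?_, ?_⟩
      · obtain ⟨l, h⟩ := hl _ (s y) (FGModuleCat.hom_ext (LinearMap.ext_ring (by
          change g.hom.hom ((1 : K) • y) = 0
          rw [one_smul, hy])))
        refine ⟨l.hom.hom (1 : K), ?_⟩
        have : f.hom.hom (l.hom.hom (1 : K)) = (1 : K) • y :=
          LinearMap.congr_fun (congrArg (fun f => f.hom.hom) h) (1 : K)
        rw [this, one_smul]
      · rintro ⟨x, rfl⟩
        exact hw x
  · rintro ⟨hf, hfg⟩
    refine ⟨FGModuleCat.hom_ext (LinearMap.ext hfg.apply_apply_eq_zero), ⟨fun a b hab => ?_⟩,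
      fun W h hh => ?_⟩
    · exact FGModuleCat.hom_ext (LinearMap.ext fun x => hf
        (LinearMap.congr_fun (congrArg (fun f => f.hom.hom) hab) x))
    · obtain ⟨r, hr⟩ := LinearMap.exists_leftInverse_of_injective f.hom.hom
        (LinearMap.ker_eq_bot.2 hf)
      refine ⟨ObjectProperty.homMk (ModuleCat.ofHom (r ∘ₗ h.hom.hom)),
        FGModuleCat.hom_ext (LinearMap.ext fun w => ?_)⟩
      obtain ⟨x, hx⟩ := (hfg (h.hom.hom w)).1
        (LinearMap.congr_fun (congrArg (fun f => f.hom.hom) hh) w)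
      change f.hom.hom (r (h.hom.hom w)) = h.hom.hom w
      rw [← hx]
      exact congrArg f.hom.hom (LinearMap.congr_fun hr x)

/-- The quotients by the ranges of g and of f serve as test objects. Conversely a linear section s
of g produces the factorization h ∘ s. -/
theorem isCokernelOf_iff {f : X ⟶ Y} {g : Y ⟶ Z} : IsCokernelOf f g ↔
    Function.Surjective g.hom.hom ∧ Function.Exact f.hom.hom g.hom.hom := by
  rw [CategoryTheory.isCokernelOf_iff]
  constructor
  · rintro ⟨w, hg, hl⟩
    have hw : ∀ x, g.hom.hom (f.hom.hom x) = 0 := fun x =>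
      LinearMap.congr_fun (congrArg (fun f => f.hom.hom) w) x
    let q {T : FGModuleCat.{u} K} (S : Submodule K T) : T ⟶ FGModuleCat.of K (T ⧸ S) :=
      ObjectProperty.homMk (ModuleCat.ofHom S.mkQ)
    constructor
    · rw [← LinearMap.range_eq_top, eq_top_iff]
      intro z _
      have h0 : q (LinearMap.range g.hom.hom) = 0 := by
        rw [← cancel_epi g, comp_zero]
        exact FGModuleCat.hom_ext (LinearMap.ext fun y =>
          (Submodule.Quotient.mk_eq_zero _).2 ⟨y, rfl⟩)
      exact (Submodule.Quotient.mk_eq_zero _).1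
        (LinearMap.congr_fun (congrArg (fun f => f.hom.hom) h0) z)
    · refine fun y => ⟨fun hy => ?_, ?_⟩
      · obtain ⟨l, h⟩ := hl _ (q (LinearMap.range f.hom.hom))
          (FGModuleCat.hom_ext (LinearMap.ext fun x =>
            (Submodule.Quotient.mk_eq_zero _).2 ⟨x, rfl⟩))
        have h' : l.hom.hom (g.hom.hom y) = (LinearMap.range f.hom.hom).mkQ y :=
          LinearMap.congr_fun (congrArg (fun f => f.hom.hom) h) y
        rw [hy, map_zero] at h'
        exact (Submodule.Quotient.mk_eq_zero _).1 h'.symm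
      · rintro ⟨x, rfl⟩
        exact hw x
  · rintro ⟨hg, hfg⟩
    refine ⟨FGModuleCat.hom_ext (LinearMap.ext hfg.apply_apply_eq_zero), ⟨fun a b hab => ?_⟩,
      fun W h hh => ?_⟩
    · refine FGModuleCat.hom_ext (LinearMap.ext fun z => ?_)
      obtain ⟨y, rfl⟩ := hg z
      exact LinearMap.congr_fun (congrArg (fun f => f.hom.hom) hab) y
    · obtain ⟨s, hs⟩ := LinearMap.exists_rightInverse_of_surjective g.hom.hom
        (LinearMap.range_eq_top.2 hg)
      refine ⟨ObjectProperty.homMk (ModuleCat.ofHom (h.hom.hom ∘ₗ s)),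
        FGModuleCat.hom_ext (LinearMap.ext fun y => ?_)⟩
      -- s(g y) and y differ by an element of ker g, which is the range of f and is killed by h.
      obtain ⟨x, hx⟩ := (hfg (s (g.hom.hom y) - y)).1 (by
        rw [map_sub, sub_eq_zero]
        exact LinearMap.congr_fun hs _)
      have : h.hom.hom (f.hom.hom x) = 0 :=
        LinearMap.congr_fun (congrArg (fun f => f.hom.hom) hh) x
      rw [hx, map_sub, sub_eq_zero] at this
      exact this

end FGModuleCat

/-! ### Exactness of the ultraproduct of vector spaces -/

namespace UProd

variable {I : Type w₀} {U : Ultrafilter I} {k : I → Type*} [∀ i, Field (k i)]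
  {V : I → Type*} [∀ i, AddCommGroup (V i)] [∀ i, Module (k i) (V i)]
  {W : I → Type*} [∀ i, AddCommGroup (W i)] [∀ i, Module (k i) (W i)]
  {T : I → Type*} [∀ i, AddCommGroup (T i)] [∀ i, Module (k i) (T i)]

theorem mapₗ_injective {f : ∀ i, V i →ₗ[k i] W i}
    (h : ∀ᶠ i in (U : Filter I), Function.Injective (f i)) : Function.Injective (mapₗ U f) :=
  ind fun _ => ind fun _ hxy => mk_eq_mk.2
    ((h.and (mk_eq_mk.1 hxy)).mono fun _ hi => hi.1 hi.2)

theorem mapₗ_surjective {f : ∀ i, V i →ₗ[k i] W i}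
    (h : ∀ᶠ i in (U : Filter I), Function.Surjective (f i)) : Function.Surjective (mapₗ U f) :=
  ind fun y => by
    obtain ⟨x, hx⟩ := eventually_exists_iff.1 (h.mono fun i hi => hi (y i))
    exact ⟨mk U x, mk_eq_mk.2 hx⟩

theorem mapₗ_exact {f : ∀ i, V i →ₗ[k i] W i} {g : ∀ i, W i →ₗ[k i] T i}
    (h : ∀ᶠ i in (U : Filter I), Function.Exact (f i) (g i)) :
    Function.Exact (mapₗ U f) (mapₗ U g) :=
  ind fun y => by
    constructor
    · intro hy
      obtain ⟨x, hx⟩ := eventually_exists_iff.1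
        ((h.and (mk_eq_mk.1 hy)).mono fun i hi => (hi.1 (y i)).1 hi.2)
      exact ⟨mk U x, mk_eq_mk.2 hx⟩
    · rintro ⟨x, hx⟩
      obtain ⟨x, rfl⟩ := mk_surjective x
      exact mk_eq_mk.2 ((h.and (mk_eq_mk.1 hx)).mono fun i hi => (hi.1 (y i)).2 ⟨_, hi.2⟩)

end UProd

/-! ### The restricted ultraproduct is abelian -/

namespace ResProd

variable {I : Type u} {U : Ultrafilter I} {k : I → Type u} [∀ i, Field (k i)]
  {C : I → Type u₁} [∀ i, Category.{u} (C i)] {ω : ∀ i, C i ⥤ FGModuleCat.{u} (k i)}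

section Preadditive

theorem mono_homMk {X Y : ResProd U ω} {f : ∀ i, X.obj.obj i ⟶ Y.obj.obj i}
    (h : ∀ᶠ i in (U : Filter I), Mono (f i)) : Mono (homMk f) where
  right_cancellation a b hab := by
    obtain ⟨a, rfl⟩ := homMk_surjective a
    obtain ⟨b, rfl⟩ := homMk_surjective b
    rw [homMk_comp, homMk_comp, homMk_eq_iff] at hab
    exact homMk_eq_iff.2 ((h.and hab).mono fun i ⟨_, h2⟩ => (cancel_mono (f i)).1 h2)

theorem epi_homMk {X Y : ResProd U ω} {f : ∀ i, X.obj.obj i ⟶ Y.obj.obj i}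
    (h : ∀ᶠ i in (U : Filter I), Epi (f i)) : Epi (homMk f) where
  left_cancellation a b hab := by
    obtain ⟨a, rfl⟩ := homMk_surjective a
    obtain ⟨b, rfl⟩ := homMk_surjective b
    rw [homMk_comp, homMk_comp, homMk_eq_iff] at hab
    exact homMk_eq_iff.2 ((h.and hab).mono fun i ⟨_, h2⟩ => (cancel_epi (f i)).1 h2)

variable [∀ i, Preadditive (C i)]

theorem homMk_zero {X Y : ResProd U ω} : homMk (fun i => (0 : X.obj.obj i ⟶ Y.obj.obj i)) = 0 := rfl

/-- The three clauses of `isKernelOf_iff` transfer separately; factorizations are chosen index by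
index. -/
theorem isKernelOf_homMk {X Y Z : ResProd U ω} {f : ∀ i, X.obj.obj i ⟶ Y.obj.obj i}
    {g : ∀ i, Y.obj.obj i ⟶ Z.obj.obj i} (h : ∀ᶠ i in (U : Filter I), IsKernelOf (f i) (g i)) :
    IsKernelOf (homMk f) (homMk g) := by
  simp only [isKernelOf_iff] at h ⊢
  refine ⟨?_, mono_homMk (h.mono fun i hi => hi.2.1), fun W a ha => ?_⟩
  · rw [homMk_comp, ← homMk_zero]
    exact homMk_eq_iff.2 (h.mono fun i hi => hi.1)
  · obtain ⟨a, rfl⟩ := homMk_surjective a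
    rw [homMk_comp, ← homMk_zero, homMk_eq_iff] at ha
    obtain ⟨l, hl⟩ := UProd.eventually_exists_iff.1
      ((h.and ha).mono fun i hi => hi.1.2.2 _ (a i) hi.2)
    exact ⟨homMk l, homMk_eq_iff.2 hl⟩

theorem isCokernelOf_homMk {X Y Z : ResProd U ω} {f : ∀ i, X.obj.obj i ⟶ Y.obj.obj i}
    {g : ∀ i, Y.obj.obj i ⟶ Z.obj.obj i} (h : ∀ᶠ i in (U : Filter I), IsCokernelOf (f i) (g i)) :
    IsCokernelOf (homMk f) (homMk g) := by
  simp only [isCokernelOf_iff] at h ⊢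
  refine ⟨?_, epi_homMk (h.mono fun i hi => hi.2.1), fun W a ha => ?_⟩
  · rw [homMk_comp, ← homMk_zero]
    exact homMk_eq_iff.2 (h.mono fun i hi => hi.1)
  · obtain ⟨a, rfl⟩ := homMk_surjective a
    rw [homMk_comp, ← homMk_zero, homMk_eq_iff] at ha
    obtain ⟨l, hl⟩ := UProd.eventually_exists_iff.1
      ((h.and ha).mono fun i hi => hi.1.2.2 _ (a i) hi.2)
    exact ⟨homMk l, homMk_eq_iff.2 hl⟩

variable [∀ i, (ω i).Additive]

section Kernels

variable [∀ i, HasKernels (C i)] [∀ i, PreservesFiniteLimits (ω i)]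

/-- The object `[ker (f i)]`. -/
noncomputable def kernelObj {X Y : ResProd U ω} (f : ∀ i, X.obj.obj i ⟶ Y.obj.obj i) :
    ResProd U ω where
  obj := ⟨fun i => kernel (f i)⟩
  -- Left exactness of ω_i embeds ω_i(ker f_i) in ω_i(X_i), so the bound for X serves.
  property := X.property.imp fun _ hn => hn.mono fun i hi => (LinearMap.finrank_le_finrank_of_injective
    (FGModuleCat.isKernelOf_iff.1 ((isKernelOf_kernel_ι (f i)).map (ω i))).1).trans hi

theorem isKernelOf_kernel_ι {X Y : ResProd U ω} (f : ∀ i, X.obj.obj i ⟶ Y.obj.obj i) :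
    IsKernelOf (homMk (X := kernelObj f) fun i => kernel.ι (f i)) (homMk f) :=
  isKernelOf_homMk (Filter.Eventually.of_forall fun i => CategoryTheory.isKernelOf_kernel_ι (f i))

instance : HasKernels (ResProd U ω) where
  has_limit f := by
    obtain ⟨f, rfl⟩ := homMk_surjective f
    exact (isKernelOf_kernel_ι f).hasKernel

/-- A monomorphism kills its kernel inclusion [ker f_i → X_i], so that class is zero; hence the
kernel inclusion of f_i is zero for almost every i. -/
theorem eventually_mono {X Y : ResProd U ω} (f : ∀ i, X.obj.obj i ⟶ Y.obj.obj i)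
    [Mono (homMk f)] : ∀ᶠ i in (U : Filter I), Mono (f i) := by
  have h := zero_of_comp_mono _ (isKernelOf_kernel_ι f).choose
  exact (homMk_eq_iff.1 (h.trans homMk_zero.symm)).mono fun i hi => Preadditive.mono_of_kernel_zero hi

end Kernels

section Cokernels

variable [∀ i, HasCokernels (C i)] [∀ i, PreservesFiniteColimits (ω i)]

/-- The object `[coker (f i)]`. -/
noncomputable def cokernelObj {X Y : ResProd U ω} (f : ∀ i, X.obj.obj i ⟶ Y.obj.obj i) :
    ResProd U ω where
  obj := ⟨fun i => cokernel (f i)⟩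
  -- Right exactness of ω_i makes ω_i(coker f_i) a quotient of ω_i(Y_i).
  property := Y.property.imp fun _ hn => hn.mono fun i hi => (LinearMap.finrank_le_finrank_of_surjective
    (FGModuleCat.isCokernelOf_iff.1 ((isCokernelOf_cokernel_π (f i)).map (ω i))).1).trans hi

theorem isCokernelOf_cokernel_π {X Y : ResProd U ω} (f : ∀ i, X.obj.obj i ⟶ Y.obj.obj i) :
    IsCokernelOf (homMk f) (homMk (Y := cokernelObj f) fun i => cokernel.π (f i)) :=
  isCokernelOf_homMk (Filter.Eventually.of_forall fun i =>
    CategoryTheory.isCokernelOf_cokernel_π (f i))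

instance : HasCokernels (ResProd U ω) where
  has_colimit f := by
    obtain ⟨f, rfl⟩ := homMk_surjective f
    exact (isCokernelOf_cokernel_π f).hasCokernel

theorem eventually_epi {X Y : ResProd U ω} (f : ∀ i, X.obj.obj i ⟶ Y.obj.obj i)
    [Epi (homMk f)] : ∀ᶠ i in (U : Filter I), Epi (f i) := by
  have h := zero_of_epi_comp _ (isCokernelOf_cokernel_π f).choose
  exact (homMk_eq_iff.1 (h.trans homMk_zero.symm)).mono fun i hi => Preadditive.epi_of_cokernel_zero hi

end Cokernels

instance : (resFunctor U ω).Additive where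
  map_add {X Y f g} := by
    obtain ⟨f, rfl⟩ := homMk_surjective f
    obtain ⟨g, rfl⟩ := homMk_surjective g
    refine FGModuleCat.hom_ext (LinearMap.ext (UProd.ind fun v => UProd.mk_congr fun i => ?_))
    exact LinearMap.congr_fun (congrArg (fun f => f.hom.hom) ((ω i).map_add (f := f i) (g := g i)))
      (v i)

instance [∀ i, Linear (k i) (C i)] [∀ i, (ω i).Linear (k i)] :
    (resFunctor U ω).Linear (UProd U k) where
  map_smul {X Y} f := UProd.ind fun a => by
    obtain ⟨f, rfl⟩ := homMk_surjective f
    refine FGModuleCat.hom_ext (LinearMap.ext (UProd.ind fun v => UProd.mk_congr fun i => ?_))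
    exact LinearMap.congr_fun (congrArg (fun f => f.hom.hom) ((ω i).map_smul (a i) (f i))) (v i)

instance [∀ i, HasTerminal (C i)] : HasTerminal (ResProd U ω) := by
  -- The identity of a terminal object is zero and ω_i is additive, so the image is the zero space
  -- and the bound 0 works.
  have h : ∀ i, Module.finrank (k i) ((ω i).obj (⊤_ (C i))) = 0 := fun i => by
    rw [Module.finrank_zero_iff]
    have : 𝟙 ((ω i).obj (⊤_ (C i))) = 0 := by
      rw [← (ω i).map_id, (terminalIsTerminal.hom_ext (𝟙 (⊤_ (C i))) 0), (ω i).map_zero]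
    exact ⟨fun a b => (LinearMap.congr_fun (congrArg (fun f => f.hom.hom) this) a).trans
      (LinearMap.congr_fun (congrArg (fun f => f.hom.hom) this) b).symm⟩
  let T : ResProd U ω := ⟨⟨fun i => ⊤_ (C i)⟩, 0, Filter.Eventually.of_forall fun i => (h i).le⟩
  have (X : ResProd U ω) : Unique (X ⟶ T) :=
    { default := 0
      uniq := fun f => by
        obtain ⟨f, rfl⟩ := homMk_surjective f
        exact homMk_eq_iff.2 (Filter.Eventually.of_forall fun i => terminalIsTerminal.hom_ext _ _) }
  exact hasTerminal_of_unique T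

instance [∀ i, HasBinaryBiproducts (C i)] : HasBinaryBiproducts (ResProd U ω) where
  has_binary_biproduct X Y := by
    have h : ∀ i, Module.finrank (k i) ((ω i).obj (X.obj.obj i ⊞ Y.obj.obj i)) ≤
        Module.finrank (k i) ((ω i).obj (X.obj.obj i)) +
          Module.finrank (k i) ((ω i).obj (Y.obj.obj i)) := fun i => by
      rw [← Module.finrank_prod]
      -- The images of the two projections are jointly injective, because applying ω_i to fst ≫ inl
      -- + snd ≫ inr = 𝟙 recovers every vector from them.
      refine LinearMap.finrank_le_finrank_of_injective (f := LinearMap.prod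
        ((ω i).map biprod.fst).hom.hom ((ω i).map biprod.snd).hom.hom) ?_
      rw [← LinearMap.ker_eq_bot, LinearMap.ker_eq_bot']
      intro x hx
      obtain ⟨h1, h2⟩ := Prod.ext_iff.1 hx
      have := congrArg (ω i).map (biprod.total (X := X.obj.obj i) (Y := Y.obj.obj i))
      rw [(ω i).map_add, (ω i).map_comp, (ω i).map_comp, (ω i).map_id] at this
      refine (LinearMap.congr_fun (congrArg (fun f => f.hom.hom) this) x).symm.trans ?_
      change ((ω i).map biprod.inl).hom.hom (((ω i).map biprod.fst).hom.hom x) +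
        ((ω i).map biprod.inr).hom.hom (((ω i).map biprod.snd).hom.hom x) = 0
      change ((ω i).map biprod.fst).hom.hom x = 0 at h1
      change ((ω i).map biprod.snd).hom.hom x = 0 at h2
      rw [h1, h2, map_zero, map_zero, add_zero]
    obtain ⟨m, hm⟩ := X.property
    obtain ⟨n, hn⟩ := Y.property
    let B : ResProd U ω := ⟨⟨fun i => X.obj.obj i ⊞ Y.obj.obj i⟩, m + n,
      (hm.and hn).mono fun i hi => (h i).trans (Nat.add_le_add hi.1 hi.2)⟩
    refine hasBinaryBiproduct_of_total
      { pt := B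
        fst := homMk fun i => biprod.fst
        snd := homMk fun i => biprod.snd
        inl := homMk fun i => biprod.inl
        inr := homMk fun i => biprod.inr
        inl_fst := homMk_eq_iff.2 (Filter.Eventually.of_forall fun i => biprod.inl_fst)
        inl_snd := homMk_eq_iff.2 (Filter.Eventually.of_forall fun i => biprod.inl_snd)
        inr_fst := homMk_eq_iff.2 (Filter.Eventually.of_forall fun i => biprod.inr_fst)
        inr_snd := homMk_eq_iff.2 (Filter.Eventually.of_forall fun i => biprod.inr_snd) } ?_
    exact homMk_eq_iff.2 (Filter.Eventually.of_forall fun i => biprod.total)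

end Preadditive

instance [∀ i, (ω i).Faithful] : (resFunctor U ω).Faithful where
  map_injective {X Y f g} hfg := by
    obtain ⟨f, rfl⟩ := homMk_surjective f
    obtain ⟨g, rfl⟩ := homMk_surjective g
    have : ∀ᶠ i in (U : Filter I), ((ω i).map (f i)).hom.hom = ((ω i).map (g i)).hom.hom :=
      UProd.mapₗ_eq_iff.1 (congrArg (fun f => f.hom.hom) hfg)
    exact homMk_eq_iff.2 (this.mono fun i hi => (ω i).map_injective (FGModuleCat.hom_ext hi))

variable [∀ i, Preadditive (C i)] [∀ i, (ω i).Additive] [∀ i, HasFiniteProducts (C i)]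

instance : HasFiniteProducts (ResProd U ω) :=
  have (i : I) : HasBinaryBiproducts (C i) := .of_hasBinaryProducts
  hasFiniteProducts_of_has_binary_and_terminal

variable [∀ i, HasKernels (C i)] [∀ i, HasCokernels (C i)]
  [∀ i, PreservesFiniteLimits (ω i)] [∀ i, PreservesFiniteColimits (ω i)]

section

variable [∀ i, IsNormalMonoCategory (C i)] [∀ i, IsNormalEpiCategory (C i)]

/-- For almost every i the morphism f_i is mono, hence the kernel of its cokernel in the abelian
category C_i; this transfers to the classes. -/
instance : IsNormalMonoCategory (ResProd U ω) where
  normalMonoOfMono {X Y} f _ := by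
    let (i : I) : Abelian (C i) := {}
    obtain ⟨f, rfl⟩ := homMk_surjective f
    obtain ⟨w, ⟨h⟩⟩ := isKernelOf_homMk (Z := cokernelObj f) (g := fun i => cokernel.π (f i))
      ((eventually_mono f).mono fun i _ => Abelian.isKernelOf_of_mono (f i))
    exact ⟨⟨_, _, w, h⟩⟩

instance : IsNormalEpiCategory (ResProd U ω) where
  normalEpiOfEpi {X Y} f _ := by
    let (i : I) : Abelian (C i) := {}
    obtain ⟨f, rfl⟩ := homMk_surjective f
    obtain ⟨w, ⟨h⟩⟩ := isCokernelOf_homMk (X := kernelObj f) (f := fun i => kernel.ι (f i))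
      ((eventually_epi f).mono fun i _ => Abelian.isCokernelOf_of_epi (f i))
    exact ⟨⟨_, _, w, h⟩⟩

noncomputable instance : Abelian (ResProd U ω) := {}

/-- For an additive functor between abelian categories kernels suffice, and an ultraproduct of exact
sequences of vector spaces is exact. -/
instance : PreservesFiniteLimits (resFunctor U ω) := by
  have {X Y : ResProd U ω} (f : X ⟶ Y) : PreservesLimit (parallelPair f 0) (resFunctor U ω) := by
    obtain ⟨f, rfl⟩ := homMk_surjective f
    have h (i : I) := FGModuleCat.isKernelOf_iff.1
      ((CategoryTheory.isKernelOf_kernel_ι (f i)).map (ω i))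
    exact (isKernelOf_kernel_ι f).preservesLimit _ (FGModuleCat.isKernelOf_iff.2
      ⟨UProd.mapₗ_injective (Filter.Eventually.of_forall fun i => (h i).1),
        UProd.mapₗ_exact (Filter.Eventually.of_forall fun i => (h i).2)⟩)
  exact (resFunctor U ω).preservesFiniteLimits_of_preservesKernels

instance : PreservesFiniteColimits (resFunctor U ω) := by
  have {X Y : ResProd U ω} (f : X ⟶ Y) : PreservesColimit (parallelPair f 0) (resFunctor U ω) := by
    obtain ⟨f, rfl⟩ := homMk_surjective f
    have h (i : I) := FGModuleCat.isCokernelOf_iff.1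
      ((CategoryTheory.isCokernelOf_cokernel_π (f i)).map (ω i))
    exact (isCokernelOf_cokernel_π f).preservesColimit _ (FGModuleCat.isCokernelOf_iff.2
      ⟨UProd.mapₗ_surjective (Filter.Eventually.of_forall fun i => (h i).1),
        UProd.mapₗ_exact (Filter.Eventually.of_forall fun i => (h i).2)⟩)
  exact (resFunctor U ω).preservesFiniteColimits_of_preservesCokernels

end

end ResProd

/-! ### The restricted ultraproduct is tannakian -/

/-- A monoidal functor preserves exact pairings. -/
@[reducible]
def CategoryTheory.ExactPairing.map {C D : Type*} [Category* C] [Category* D] [MonoidalCategory C]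
    [MonoidalCategory D] (F : C ⥤ D) [F.Monoidal] (X Y : C) [ExactPairing X Y] :
    ExactPairing (F.obj X) (F.obj Y) where
  coevaluation' := Functor.LaxMonoidal.ε F ≫ F.map (η_ X Y) ≫ Functor.OplaxMonoidal.δ F X Y
  evaluation' := Functor.LaxMonoidal.μ F Y X ≫ F.map (ε_ X Y) ≫ Functor.OplaxMonoidal.η F
  coevaluation_evaluation' := by
    have h := congrArg F.map (ExactPairing.coevaluation_evaluation X Y)
    simp only [Functor.map_comp, Functor.Monoidal.map_whiskerLeft,
      Functor.Monoidal.map_whiskerRight, Functor.Monoidal.map_associator_inv,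
      Functor.Monoidal.map_leftUnitor_inv, Functor.Monoidal.map_rightUnitor, Category.assoc,
      Functor.Monoidal.μ_δ_assoc] at h
    -- Composing with the invertible unit and tensor constraints turns the required zigzag identity
    -- into the image under F of the one in C.
    rw [← cancel_epi (F.obj Y ◁ Functor.OplaxMonoidal.η F),
      ← cancel_epi (Functor.OplaxMonoidal.δ F Y (𝟙_ C)),
      ← cancel_mono (Functor.LaxMonoidal.ε F ▷ F.obj Y),
      ← cancel_mono (Functor.LaxMonoidal.μ F (𝟙_ C) Y)]
    simpa using h
  evaluation_coevaluation' := by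
    have h := congrArg F.map (ExactPairing.evaluation_coevaluation X Y)
    simp only [Functor.map_comp, Functor.Monoidal.map_whiskerLeft,
      Functor.Monoidal.map_whiskerRight, Functor.Monoidal.map_associator,
      Functor.Monoidal.map_leftUnitor, Functor.Monoidal.map_rightUnitor_inv, Category.assoc,
      Functor.Monoidal.μ_δ_assoc] at h
    rw [← cancel_epi (Functor.OplaxMonoidal.η F ▷ F.obj X),
      ← cancel_epi (Functor.OplaxMonoidal.δ F (𝟙_ C) X),
      ← cancel_mono (F.obj X ◁ Functor.LaxMonoidal.ε F),
      ← cancel_mono (Functor.LaxMonoidal.μ F X (𝟙_ C))]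
    simpa using h

/-- Duals are unique up to isomorphism, so Y is isomorphic to the linear dual of X. -/
theorem FGModuleCat.finrank_eq_of_exactPairing {K : Type u} [Field K] (X Y : FGModuleCat.{u} K)
    [ExactPairing X Y] : Module.finrank K Y = Module.finrank K X :=
  (FGModuleCat.isoToLinearEquiv (rightDualIso (X := X) inferInstance
    (FGModuleCat.exactPairing K X))).finrank_eq.trans Subspace.dual_finrank_eq

namespace ResProd

variable {I : Type u} {U : Ultrafilter I} {k : I → Type u} [∀ i, Field (k i)]
  {C : I → Type u₁} [∀ i, Category.{u} (C i)] {ω : ∀ i, C i ⥤ FGModuleCat.{u} (k i)}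
  [∀ i, MonoidalCategory (C i)]

section Preadditive

variable [∀ i, Preadditive (C i)] [∀ i, MonoidalPreadditive (C i)]

instance : MonoidalPreadditive (UProdCat U C) where
  whiskerLeft_zero := UProd.mk_congr fun _ => MonoidalPreadditive.whiskerLeft_zero
  zero_whiskerRight := UProd.mk_congr fun _ => MonoidalPreadditive.zero_whiskerRight
  whiskerLeft_add := UProd.ind fun _ => UProd.ind fun _ =>
    UProd.mk_congr fun _ => MonoidalPreadditive.whiskerLeft_add _ _
  add_whiskerRight := UProd.ind fun _ => UProd.ind fun _ =>
    UProd.mk_congr fun _ => MonoidalPreadditive.add_whiskerRight _ _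

instance [∀ i, Linear (k i) (C i)] [∀ i, MonoidalLinear (k i) (C i)] :
    MonoidalLinear (UProd U k) (UProdCat U C) where
  whiskerLeft_smul _ _ _ := UProd.ind fun _ => UProd.ind fun _ =>
    UProd.mk_congr fun _ => MonoidalLinear.whiskerLeft_smul _ _ _
  smul_whiskerRight := UProd.ind fun _ _ _ => UProd.ind fun _ _ =>
    UProd.mk_congr fun _ => MonoidalLinear.smul_whiskerRight _ _ _

end Preadditive

variable [∀ i, (ω i).Monoidal]

theorem bijective_end_unit [∀ i, Preadditive (C i)] [∀ i, Linear (k i) (C i)]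
    (h : ∀ i, Function.Bijective fun a : k i => a • 𝟙 (𝟙_ (C i))) :
    Function.Bijective fun a : UProd U k => a • 𝟙 (𝟙_ (ResProd U ω)) := by
  constructor
  · refine UProd.ind fun a => UProd.ind fun b hab => UProd.mk_eq_mk.2 ?_
    have : ∀ᶠ i in (U : Filter I), a i • 𝟙 (𝟙_ (C i)) = b i • 𝟙 (𝟙_ (C i)) :=
      UProd.mk_eq_mk.1 (congrArg InducedCategory.Hom.hom hab)
    exact this.mono fun i hi => (h i).1 hi
  · intro f
    obtain ⟨f, rfl⟩ := homMk_surjective f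
    choose a ha using fun i => (h i).2 (f i)
    exact ⟨UProd.mk U a, ObjectProperty.hom_ext _ (UProd.mk_congr ha)⟩

/-- The dual object `[(X i)ᘁ]`. -/
def dual [∀ i, RightRigidCategory (C i)] (X : ResProd U ω) : ResProd U ω where
  obj := ⟨fun i => (X.obj.obj i)ᘁ⟩
  property := X.property.imp fun _ hn => hn.mono fun i hi =>
    -- ω_i carries the duality to vector spaces, where it preserves dimension, so the bound for X
    -- serves for its dual.
    haveI := ExactPairing.map (ω i) (X.obj.obj i) (X.obj.obj i)ᘁ
    (FGModuleCat.finrank_eq_of_exactPairing ((ω i).obj (X.obj.obj i))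
      ((ω i).obj (X.obj.obj i)ᘁ)).le.trans hi

instance [∀ i, RightRigidCategory (C i)] (X : ResProd U ω) : ExactPairing X (dual X) where
  coevaluation' := homMk (X := 𝟙_ (ResProd U ω)) (Y := X ⊗ dual X) fun i =>
    η_ (X.obj.obj i) (X.obj.obj i)ᘁ
  evaluation' := homMk (X := dual X ⊗ X) (Y := 𝟙_ (ResProd U ω)) fun i =>
    ε_ (X.obj.obj i) (X.obj.obj i)ᘁ
  coevaluation_evaluation' := ObjectProperty.hom_ext _ (UProd.mk_congr fun i =>
    ExactPairing.coevaluation_evaluation (X.obj.obj i) (X.obj.obj i)ᘁ)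
  evaluation_coevaluation' := ObjectProperty.hom_ext _ (UProd.mk_congr fun i =>
    ExactPairing.evaluation_coevaluation (X.obj.obj i) (X.obj.obj i)ᘁ)

instance [∀ i, RightRigidCategory (C i)] : RightRigidCategory (ResProd U ω) where
  rightDual X := ⟨dual X⟩

end ResProd

theorem isTannakian_and_isFibreFunctor_resFunctor {I : Type u} (U : Ultrafilter I)
    {k : I → Type u} [∀ i, Field (k i)] {C : I → Type u₁} [∀ i, Category.{u} (C i)]
    [∀ i, Preadditive (C i)] [∀ i, Linear (k i) (C i)] [∀ i, MonoidalCategory (C i)]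
    [∀ i, SymmetricCategory (C i)] [h : ∀ i, IsTannakian (k i) (C i)]
    (ω : ∀ i, C i ⥤ FGModuleCat.{u} (k i)) [∀ i, (ω i).Braided]
    [h' : ∀ i, IsFibreFunctor (k i) (ω i)] :
    IsTannakian (UProd U k) (ResProd U ω) ∧ IsFibreFunctor (UProd U k) (resFunctor U ω) := by
  have i1 (i : I) := (h i).hasFiniteProducts
  have i2 (i : I) := (h i).hasKernels
  have i3 (i : I) := (h i).hasCokernels
  have i4 (i : I) := (h i).isNormalMonoCategory
  have i5 (i : I) := (h i).isNormalEpiCategory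
  have i6 (i : I) := (h i).monoidalPreadditive
  have i7 (i : I) := (h i).monoidalLinear
  have i8 (i : I) : RightRigidCategory (C i) := (h i).rigid.some.toRightRigidCategory
  have j1 (i : I) := (h' i).faithful
  have j2 (i : I) := (h' i).additive
  have j3 (i : I) := (h' i).linear
  have j4 (i : I) := (h' i).preservesFiniteLimits
  have j5 (i : I) := (h' i).preservesFiniteColimits
  exact ⟨{
    hasFiniteProducts := inferInstance
    hasKernels := inferInstance
    hasCokernels := inferInstance
    isNormalMonoCategory := inferInstance
    isNormalEpiCategory := inferInstance
    monoidalPreadditive := inferInstance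
    monoidalLinear := inferInstance
    -- Only right duals were constructed; the braiding turns them into left duals.
    rigid := ⟨BraidedCategory.rigidCategoryOfRightRigidCategory⟩
    bijective_end_unit := ResProd.bijective_end_unit fun i => (h i).bijective_end_unit }, {
    faithful := inferInstance
    additive := inferInstance
    linear := inferInstance
    preservesFiniteLimits := inferInstance
    preservesFiniteColimits := inferInstance }⟩

/-! ### Matrix coefficients of comodules -/

section Comatrix

variable {K A : Type*} [Field K] [CommRing A] [HopfAlgebra K A]
  {J J' : Type*} [Fintype J] [DecidableEq J] [Fintype J'] [DecidableEq J']

variable (K) in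
/-- A matrix with `Δ x_{jl} = ∑ x_{jm} ⊗ x_{ml}` and `ε x_{jl} = δ_{jl}`: the matrix of
coefficients of a comodule. -/
structure IsComatrix (x : Matrix J J A) : Prop where
  comul : ∀ j l, CoalgebraStruct.comul (R := K) (x j l) = ∑ m, x j m ⊗ₜ[K] x m l
  counit : ∀ j l, CoalgebraStruct.counit (R := K) (x j l) = (1 : Matrix J J K) j l

namespace IsComatrix

theorem one : IsComatrix K (1 : Matrix J J A) where
  comul j l := by
    by_cases h : j = l <;>
      simp [h, Matrix.one_apply, Algebra.TensorProduct.one_def, TensorProduct.tmul_ite]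
  counit j l := by
    simp only [Matrix.one_apply, apply_ite (CoalgebraStruct.counit (R := K) (A := A)), map_zero,
      Bialgebra.counit_one]

-- The Kronecker product is the coefficient matrix of a tensor product of comodules; it makes the
-- span of coefficients closed under multiplication.
open scoped Kronecker in
theorem kronecker {x : Matrix J J A} {y : Matrix J' J' A} (hx : IsComatrix K x)
    (hy : IsComatrix K y) : IsComatrix K (x ⊗ₖ y) where
  comul j l := by
    simp only [Matrix.kroneckerMap_apply, Bialgebra.comul_mul, hx.comul, hy.comul,
      Finset.sum_mul_sum, Algebra.TensorProduct.tmul_mul_tmul, Fintype.sum_prod_type]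
  counit j l := by
    simp only [Matrix.kroneckerMap_apply, Bialgebra.counit_mul, hx.counit, hy.counit,
      ← Matrix.one_kronecker_one (m := J) (n := J')]

theorem antipode_mul {x : Matrix J J A} (hx : IsComatrix K x) :
    x.map (HopfAlgebra.antipode K) * x = 1 := by
  ext j l
  have h := HopfAlgebra.mul_antipode_rTensor_comul_apply (R := K) (x j l)
  rw [hx.comul, hx.counit] at h
  simpa [Matrix.mul_apply, Matrix.one_apply, apply_ite (algebraMap K A)] using h

theorem mul_antipode {x : Matrix J J A} (hx : IsComatrix K x) :
    x * x.map (HopfAlgebra.antipode K) = 1 := by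
  ext j l
  have h := HopfAlgebra.mul_antipode_lTensor_comul_apply (R := K) (x j l)
  rw [hx.comul, hx.counit] at h
  simpa [Matrix.mul_apply, Matrix.one_apply, apply_ite (algebraMap K A)] using h

/-- This is the coefficient matrix of the dual comodule. Write p(x) and q(x) for the images of x
under a ↦ a ⊗ 1 and a ↦ 1 ⊗ a. Then Δ(x) = p(x) q(x), and the ring homomorphisms Δ, p, q carry the
inverse s = S(x) to inverses, so Δ(s) = q(s) p(s) by uniqueness of inverses. -/
theorem antipode {x : Matrix J J A} (hx : IsComatrix K x) :
    IsComatrix K (x.map (HopfAlgebra.antipode K)).transpose where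
  comul j l := by
    let Δ : A →+* A ⊗[K] A := (Bialgebra.comulAlgHom K A : A →+* A ⊗[K] A)
    let p : A →+* A ⊗[K] A := (Algebra.TensorProduct.includeLeft : A →ₐ[K] A ⊗[K] A)
    let q : A →+* A ⊗[K] A := (Algebra.TensorProduct.includeRight : A →ₐ[K] A ⊗[K] A)
    let s := x.map (HopfAlgebra.antipode K)
    have h1 (r : A →+* A ⊗[K] A) : r.mapMatrix s * r.mapMatrix x = 1 := by
      rw [← map_mul, hx.antipode_mul, map_one]
    have h2 (r : A →+* A ⊗[K] A) : r.mapMatrix x * r.mapMatrix s = 1 := by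
      rw [← map_mul, hx.mul_antipode, map_one]
    have h3 : Δ.mapMatrix x = p.mapMatrix x * q.mapMatrix x := by
      ext j l
      simpa [Matrix.mul_apply, Δ, p, q] using hx.comul j l
    have h4 : Δ.mapMatrix s = q.mapMatrix s * p.mapMatrix s := by
      refine left_inv_eq_right_inv (h1 Δ) ?_
      rw [h3, mul_assoc, ← mul_assoc (q.mapMatrix x), h2, one_mul, h2]
    have h5 := congrFun (congrFun h4 l) j
    simpa [Matrix.mul_apply, Δ, p, q, s] using h5
  counit j l := by
    simp [hx.counit, Matrix.one_apply, eq_comm]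

end IsComatrix

end Comatrix

namespace UProd

/-! ### The Hopf algebra of the restricted ultraproduct -/

section Ring

variable {I : Type w₀} {U : Ultrafilter I} {k : I → Type*} [∀ i, Field (k i)]
  {A : I → Type*} [∀ i, CommRing (A i)]

/-- The low priority leaves the earlier structure in force for families of fields. -/
instance (priority := low) : CommRing (UProd U A) where
  mul := map₂ fun _ a b => a * b
  one := mk U fun _ => 1
  mul_assoc := ind fun _ => ind fun _ => ind fun _ => mk_congr fun _ => mul_assoc _ _ _
  one_mul := ind fun _ => mk_congr fun _ => one_mul _
  mul_one := ind fun _ => mk_congr fun _ => mul_one _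
  mul_comm := ind fun _ => ind fun _ => mk_congr fun _ => mul_comm _ _
  left_distrib := ind fun _ => ind fun _ => ind fun _ => mk_congr fun _ => left_distrib _ _ _
  right_distrib := ind fun _ => ind fun _ => ind fun _ => mk_congr fun _ => right_distrib _ _ _
  zero_mul := ind fun _ => mk_congr fun _ => zero_mul _
  mul_zero := ind fun _ => mk_congr fun _ => mul_zero _
  zsmul := zsmulRec
  neg_add_cancel := neg_add_cancel
  sub_eq_add_neg := sub_eq_add_neg

theorem mk_mul (a b : ∀ i, A i) : mk U a * mk U b = mk U fun i => a i * b i := rfl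

noncomputable instance (priority := low) [∀ i, Algebra (k i) (A i)] :
    Algebra (UProd U k) (UProd U A) :=
  Algebra.ofModule
    (ind fun _ => ind fun _ => ind fun _ => mk_congr fun _ => smul_mul_assoc _ _ _)
    (ind fun _ => ind fun _ => ind fun _ => mk_congr fun _ => mul_smul_comm _ _ _)

end Ring

section Coeff

variable {I : Type w₀} (U : Ultrafilter I) {k : I → Type*} [∀ i, Field (k i)]
  (A : I → Type*) [∀ i, CommRing (A i)] [∀ i, HopfAlgebra (k i) (A i)]

variable (k) in
/-- The ultraproducts of coefficients of comodules of a fixed dimension. -/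
def coeffs : Set (UProd U A) :=
  {b | ∃ (J : Type) (_ : Fintype J) (_ : DecidableEq J) (x : ∀ i, Matrix J J (A i)),
    (∀ i, IsComatrix (k i) (x i)) ∧ ∃ j l, (mk U fun i => x i j l) = b}

theorem one_mem_coeffs : (1 : UProd U A) ∈ coeffs U k A :=
  ⟨Unit, inferInstance, inferInstance, fun _ => 1, fun _ => .one, (), (), rfl⟩

theorem mul_mem_coeffs {a b : UProd U A} (ha : a ∈ coeffs U k A) (hb : b ∈ coeffs U k A) :
    a * b ∈ coeffs U k A := by
  obtain ⟨J, _, _, x, hx, j, l, rfl⟩ := ha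
  obtain ⟨J', _, _, y, hy, j', l', rfl⟩ := hb
  exact ⟨J × J', inferInstance, inferInstance, _, fun i => (hx i).kronecker (hy i), (j, j'),
    (l, l'), rfl⟩

variable (k) in
/-- The algebra spanned by the ultraproducts of coefficients of comodules of a fixed dimension. -/
noncomputable def coeffSubalgebra : Subalgebra (UProd U k) (UProd U A) :=
  (Submodule.span (UProd U k) (coeffs U k A)).toSubalgebra
    (Submodule.subset_span (one_mem_coeffs U A)) fun a b ha hb => by
      have h := Submodule.mul_mem_mul ha hb
      rw [Submodule.span_mul_span] at h
      refine Submodule.span_mono ?_ h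
      rintro _ ⟨a, ha, b, hb, rfl⟩
      exact mul_mem_coeffs U A ha hb

variable (k) in
/-- The Hopf algebra of the restricted ultraproduct of the categories `FinRep (k i) (A i)`. -/
abbrev CoeffAlg : Type _ := coeffSubalgebra U k A

end Coeff

namespace CoeffAlg

variable {I : Type w₀} {U : Ultrafilter I} {k : I → Type*} [∀ i, Field (k i)]
  {A : I → Type*} [∀ i, CommRing (A i)] [∀ i, HopfAlgebra (k i) (A i)]

/-- The class of a family of coefficients. -/
def coeff {J : Type} [Fintype J] [DecidableEq J] {x : ∀ i, Matrix J J (A i)}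
    (hx : ∀ i, IsComatrix (k i) (x i)) (j l : J) : CoeffAlg U k A :=
  ⟨mk U fun i => x i j l, Submodule.subset_span ⟨J, _, _, x, hx, j, l, rfl⟩⟩

theorem induction_on {p : CoeffAlg U k A → Prop} (b : CoeffAlg U k A)
    (coeff : ∀ {J : Type} [Fintype J] [DecidableEq J] {x : ∀ i, Matrix J J (A i)}
      (hx : ∀ i, IsComatrix (k i) (x i)) (j l : J), p (coeff hx j l))
    (zero : p 0) (add : ∀ a b, p a → p b → p (a + b))
    (smul : ∀ (c : UProd U k) a, p a → p (c • a)) : p b := by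
  obtain ⟨b, hb⟩ := b
  induction hb using Submodule.span_induction with
  | mem b hb =>
    obtain ⟨J, _, _, x, hx, j, l, rfl⟩ := hb
    exact coeff hx j l
  | zero => exact zero
  | add a b _ _ h h' => exact add _ _ h h'
  | smul c a _ h => exact smul c _ h

theorem linearMap_ext {M : Type*} [AddCommGroup M] [Module (UProd U k) M]
    {f g : CoeffAlg U k A →ₗ[UProd U k] M}
    (h : ∀ {J : Type} [Fintype J] [DecidableEq J] {x : ∀ i, Matrix J J (A i)}
      (hx : ∀ i, IsComatrix (k i) (x i)) (j l : J), f (coeff hx j l) = g (coeff hx j l)) :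
    f = g := by
  ext b
  induction b using induction_on with
  | coeff hx j l => exact h hx j l
  | zero => simp only [map_zero]
  | add a b ha hb => simp only [map_add, ha, hb]
  | smul c a ha => simp only [map_smul, ha]

/-- The inclusion into the ultraproduct of the algebras `A i`. -/
noncomputable def incl : CoeffAlg U k A →ₗ[UProd U k] UProd U A :=
  (coeffSubalgebra U k A).val.toLinearMap

theorem incl_injective : Function.Injective (incl : CoeffAlg U k A →ₗ[UProd U k] UProd U A) :=
  Subtype.val_injective

@[simp] theorem incl_coeff {J : Type} [Fintype J] [DecidableEq J] {x : ∀ i, Matrix J J (A i)}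
    (hx : ∀ i, IsComatrix (k i) (x i)) (j l : J) :
    incl (coeff (U := U) hx j l) = mk U fun i => x i j l := rfl

/-- The comparison map `∏_U V i ⊗ B → ∏_U (V i ⊗ A i)`. -/
noncomputable def tensorIncl (V : I → Type*) [∀ i, AddCommGroup (V i)] [∀ i, Module (k i) (V i)] :
    UProd U V ⊗[UProd U k] CoeffAlg U k A →ₗ[UProd U k] UProd U fun i => V i ⊗[k i] A i :=
  tensorMap U k V A ∘ₗ incl.lTensor (UProd U V)

theorem tensorIncl_tmul (V : I → Type*) [∀ i, AddCommGroup (V i)] [∀ i, Module (k i) (V i)]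
    (v : UProd U V) (b : CoeffAlg U k A) :
    tensorIncl V (v ⊗ₜ b) = tensorMap U k V A (v ⊗ₜ incl b) := rfl

/-- Over a field tensoring preserves the injection of the coefficient algebra into ∏A_i. Identities
in ∏V_i ⊗ B can therefore be verified componentwise in ∏(V_i ⊗ A_i). -/
theorem tensorIncl_injective (V : I → Type*) [∀ i, AddCommGroup (V i)] [∀ i, Module (k i) (V i)] :
    Function.Injective (tensorIncl (U := U) (k := k) (A := A) V) :=
  tensorMap_injective.comp (Module.Flat.lTensor_preserves_injective_linearMap _ incl_injective)

theorem tensorIncl_comp_incl_injective : Function.Injective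
    (tensorIncl (U := U) (k := k) (A := A) A ∘ₗ incl.rTensor (CoeffAlg U k A)) :=
  (tensorIncl_injective A).comp (Module.Flat.rTensor_preserves_injective_linearMap _ incl_injective)

/-- Apply the componentwise comultiplication, then a linear left inverse r of the embedding of B ⊗ B
in ∏(A_i ⊗ A_i). On coefficients the componentwise value already lies in B ⊗ B, so the choice of r
is immaterial. -/
theorem exists_comul : ∃ φ : CoeffAlg U k A →ₗ[UProd U k] CoeffAlg U k A ⊗[UProd U k] CoeffAlg U k A,
    ∀ {J : Type} [Fintype J] [DecidableEq J] {x : ∀ i, Matrix J J (A i)}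
      (hx : ∀ i, IsComatrix (k i) (x i)) (j l : J),
      φ (coeff hx j l) = ∑ m, coeff hx j m ⊗ₜ coeff hx m l := by
  obtain ⟨r, hr⟩ := LinearMap.exists_leftInverse_of_injective _
    (LinearMap.ker_eq_bot.2 (tensorIncl_comp_incl_injective (U := U) (k := k) (A := A)))
  refine ⟨r ∘ₗ mapₗ U (fun i => CoalgebraStruct.comul) ∘ₗ incl, fun {J} _ _ x hx j l => ?_⟩
  refine Eq.trans (congrArg r ?_)
    (LinearMap.congr_fun hr (∑ m, coeff hx j m ⊗ₜ coeff hx m l))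
  rw [map_sum]
  simp only [LinearMap.comp_apply, LinearMap.rTensor_tmul, tensorIncl_tmul, incl_coeff,
    tensorMap_mk, mapₗ_mk, mk_sum]
  exact mk_congr fun i => (hx i).comul j l

/-- Same device: the componentwise antipode sends coefficients to coefficients of the dual
comodules, so a left inverse of the inclusion corestricts it to B. -/
theorem exists_antipode : ∃ φ : CoeffAlg U k A →ₗ[UProd U k] CoeffAlg U k A,
    ∀ {J : Type} [Fintype J] [DecidableEq J] {x : ∀ i, Matrix J J (A i)}
      (hx : ∀ i, IsComatrix (k i) (x i)) (j l : J),
      φ (coeff hx j l) = coeff (fun i => (hx i).antipode) l j := by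
  obtain ⟨r, hr⟩ := LinearMap.exists_leftInverse_of_injective _
    (LinearMap.ker_eq_bot.2 (incl_injective (U := U) (k := k) (A := A)))
  exact ⟨r ∘ₗ mapₗ U (fun i => HopfAlgebra.antipode (k i)) ∘ₗ incl, fun hx j l =>
    LinearMap.congr_fun hr (coeff (fun i => (hx i).antipode) l j)⟩

noncomputable instance : CoalgebraStruct (UProd U k) (CoeffAlg U k A) where
  comul := exists_comul.choose
  counit :=
    { toFun := fun b => map (fun _ a => CoalgebraStruct.counit a) (incl b)
      map_add' := fun a b => map_add (mapₗ U fun i => CoalgebraStruct.counit (R := k i) (A := A i))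
        (incl a) (incl b)
      map_smul' := fun c b => map_smul
        (mapₗ U fun i => CoalgebraStruct.counit (R := k i) (A := A i)) c (incl b) }

section

variable {J : Type} [Fintype J] [DecidableEq J] {x : ∀ i, Matrix J J (A i)}
  (hx : ∀ i, IsComatrix (k i) (x i)) (j l : J)

theorem comul_coeff : CoalgebraStruct.comul (R := UProd U k) (coeff (U := U) hx j l) =
    ∑ m, coeff hx j m ⊗ₜ coeff hx m l := exists_comul.choose_spec hx j l

theorem counit_coeff : CoalgebraStruct.counit (R := UProd U k) (coeff (U := U) hx j l) =
    (1 : Matrix J J (UProd U k)) j l := by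
  refine (mk_congr fun i => (hx i).counit j l).trans ?_
  by_cases h : j = l
  · subst h
    simp only [Matrix.one_apply_eq]
    rfl
  · simp only [Matrix.one_apply_ne h]
    rfl

open scoped Kronecker in
theorem coeff_mul_coeff {J' : Type} [Fintype J'] [DecidableEq J'] {y : ∀ i, Matrix J' J' (A i)}
    (hy : ∀ i, IsComatrix (k i) (y i)) (j' l' : J') :
    coeff (U := U) hx j l * coeff hy j' l' =
      coeff (fun i => (hx i).kronecker (hy i)) (j, j') (l, l') := rfl

theorem one_eq_coeff :
    (1 : CoeffAlg U k A) = coeff (fun i => IsComatrix.one (K := k i) (J := Unit)) () () := rfl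

end

/-- The axioms are equalities of linear maps, so coefficients suffice; there they express
associativity and unit laws of matrix multiplication. -/
noncomputable instance : Coalgebra (UProd U k) (CoeffAlg U k A) where
  coassoc := linearMap_ext fun hx j l => by
    simp only [LinearMap.comp_apply, comul_coeff, map_sum, LinearMap.rTensor_tmul,
      LinearMap.lTensor_tmul, TensorProduct.sum_tmul, TensorProduct.tmul_sum,
      LinearEquiv.coe_coe, TensorProduct.assoc_tmul]
    exact Finset.sum_comm
  rTensor_counit_comp_comul := linearMap_ext fun hx j l => by
    simp [comul_coeff, counit_coeff, Matrix.one_apply, TensorProduct.ite_tmul]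
  lTensor_counit_comp_comul := linearMap_ext fun hx j l => by
    simp [comul_coeff, counit_coeff, Matrix.one_apply, TensorProduct.tmul_ite]

noncomputable instance : Bialgebra (UProd U k) (CoeffAlg U k A) where
  counit_one := by rw [one_eq_coeff, counit_coeff, Matrix.one_apply_eq]
  mul_compr₂_counit := linearMap_ext fun hx j l => linearMap_ext fun hy j' l' => by
    simp only [LinearMap.compr₂_apply, LinearMap.compl₁₂_apply, LinearMap.mul_apply',
      coeff_mul_coeff, counit_coeff, ← Matrix.one_kronecker_one, Matrix.kroneckerMap_apply]
  comul_one := by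
    rw [one_eq_coeff, comul_coeff]
    simp [← one_eq_coeff, Algebra.TensorProduct.one_def]
  mul_compr₂_comul := linearMap_ext fun hx j l => linearMap_ext fun hy j' l' => by
    simp only [LinearMap.compr₂_apply, LinearMap.compl₁₂_apply, LinearMap.mul_apply',
      coeff_mul_coeff, comul_coeff, Finset.sum_mul_sum, Algebra.TensorProduct.tmul_mul_tmul,
      Fintype.sum_prod_type]

/-- The antipode. -/
noncomputable def antipode : CoeffAlg U k A →ₗ[UProd U k] CoeffAlg U k A := exists_antipode.choose

theorem antipode_coeff {J : Type} [Fintype J] [DecidableEq J] {x : ∀ i, Matrix J J (A i)}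
    (hx : ∀ i, IsComatrix (k i) (x i)) (j l : J) :
    antipode (coeff (U := U) hx j l) = coeff (fun i => (hx i).antipode) l j :=
  exists_antipode.choose_spec hx j l

theorem incl_algebraMap_one_apply {J : Type} [DecidableEq J] (j l : J) :
    incl (algebraMap (UProd U k) (CoeffAlg U k A) ((1 : Matrix J J (UProd U k)) j l)) =
      mk U fun i => (1 : Matrix J J (A i)) j l := by
  by_cases h : j = l
  · subst h
    simp only [Matrix.one_apply_eq, map_one]
    rfl
  · simp only [Matrix.one_apply_ne h, map_zero]
    rfl

/-- On coefficients and after inclusion in ∏A_i, the antipode axioms say that S(x_i) is a two-sided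
inverse of the matrix x_i. -/
noncomputable instance : HopfAlgebra (UProd U k) (CoeffAlg U k A) where
  antipode := antipode
  mul_antipode_rTensor_comul := linearMap_ext fun {J} _ _ x hx j l => by
    refine incl_injective ?_
    simp only [LinearMap.comp_apply, comul_coeff, map_sum, LinearMap.rTensor_tmul, antipode_coeff,
      LinearMap.mul'_apply, counit_coeff, Algebra.linearMap_apply, incl_algebraMap_one_apply]
    refine (mk_sum _ _).trans (mk_congr fun i => ?_)
    rw [← (hx i).antipode_mul]
    rfl
  mul_antipode_lTensor_comul := linearMap_ext fun {J} _ _ x hx j l => by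
    refine incl_injective ?_
    simp only [LinearMap.comp_apply, comul_coeff, map_sum, LinearMap.lTensor_tmul, antipode_coeff,
      LinearMap.mul'_apply, counit_coeff, Algebra.linearMap_apply, incl_algebraMap_one_apply]
    refine (mk_sum _ _).trans (mk_congr fun i => ?_)
    rw [← (hx i).mul_antipode]
    rfl

end CoeffAlg

end UProd

/-! ### Comodules and their matrices of coefficients -/

theorem Module.Basis.sum_tmul_coord {K V W J : Type*} [Field K] [AddCommGroup V] [Module K V]
    [AddCommGroup W] [Module K W] [Fintype J] (b : Module.Basis J K V) (t : V ⊗[K] W) :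
    ∑ j, b j ⊗ₜ TensorProduct.lid K W ((b.coord j).rTensor W t) = t := by
  induction t using TensorProduct.induction_on with
  | zero => simp
  | add s t hs ht =>
    simp only [map_add, TensorProduct.tmul_add, Finset.sum_add_distrib, hs, ht]
  | tmul v w =>
    simp only [LinearMap.rTensor_tmul, TensorProduct.lid_tmul, TensorProduct.tmul_smul]
    conv_rhs => rw [← b.sum_repr v, TensorProduct.sum_tmul]
    rfl

theorem LinearIndependent.eq_of_sum_tmul_eq {K V W J : Type*} [Field K]
    [AddCommGroup V] [Module K V] [AddCommGroup W] [Module K W] [Fintype J] {x : J → V}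
    (hx : LinearIndependent K x) {y z : J → W}
    (h : ∑ j, x j ⊗ₜ[K] y j = ∑ j, x j ⊗ₜ[K] z j) (j : J) : y j = z j := by
  rw [← sub_eq_zero, ← Finset.sum_sub_distrib] at h
  simp only [← TensorProduct.tmul_sub] at h
  exact sub_eq_zero.1 (hx.eq_zero_of_sum_tmul_eq_zero h j)

namespace FinRep

variable {k : Type u} [Field k] {A : Type u} [CommRing A] [HopfAlgebra k A]

/-- The entries are the coordinates of ρ(b_l). Comparing the components along b_j in the
coassociativity and counit laws gives the two comatrix identities. -/
theorem exists_isComatrix (X : FinRep k A) {J : Type*} [Fintype J] [DecidableEq J]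
    (b : Module.Basis J k X.V) :
    ∃ x : Matrix J J A, IsComatrix k x ∧ ∀ l, X.ρ (b l) = ∑ j, b j ⊗ₜ[k] x j l := by
  let x : Matrix J J A := fun j l => TensorProduct.lid k A ((b.coord j).rTensor A (X.ρ (b l)))
  have hx : ∀ l, X.ρ (b l) = ∑ j, b j ⊗ₜ[k] x j l := fun l => (b.sum_tmul_coord _).symm
  refine ⟨x, ⟨fun j l => ?_, fun j l => ?_⟩, hx⟩
  · refine b.linearIndependent.eq_of_sum_tmul_eq
      (y := fun j => CoalgebraStruct.comul (x j l)) (z := fun j => ∑ m, x j m ⊗ₜ[k] x m l) ?_ j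
    have h := X.coassoc (b l)
    simp only [hx, map_sum, LinearMap.rTensor_tmul, LinearMap.lTensor_tmul,
      TensorProduct.sum_tmul, TensorProduct.assoc_tmul] at h
    rw [← h, Finset.sum_comm]
    simp only [TensorProduct.tmul_sum]
  · refine b.linearIndependent.eq_of_sum_tmul_eq
      (y := fun j => CoalgebraStruct.counit (x j l)) (z := fun j => (1 : Matrix J J k) j l) ?_ j
    have h := X.counit (b l)
    simp only [hx, map_sum, LinearMap.lTensor_tmul] at h
    rw [h]
    simp [Matrix.one_apply, TensorProduct.tmul_ite]

/-- The comodule with a given matrix of coefficients. -/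
noncomputable def ofComatrix {J : Type} [Fintype J] [DecidableEq J] {x : Matrix J J A}
    (hx : IsComatrix k x) : FinRep k A where
  V := FGModuleCat.of k (J → k)
  ρ := (Pi.basisFun k J).constr k fun l => ∑ j, Pi.basisFun k J j ⊗ₜ[k] x j l
  coassoc v := by
    let ρ := (Pi.basisFun k J).constr k fun l => ∑ j, Pi.basisFun k J j ⊗ₜ[k] x j l
    refine LinearMap.congr_fun (f := (TensorProduct.assoc k (J → k) A A).toLinearMap ∘ₗ
      ρ.rTensor A ∘ₗ ρ) (g := (CoalgebraStruct.comul (R := k) (A := A)).lTensor (J → k) ∘ₗ ρ)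
      ((Pi.basisFun k J).ext fun l => ?_) v
    simp only [LinearMap.comp_apply, ρ, Module.Basis.constr_basis, map_sum,
      LinearMap.rTensor_tmul, LinearMap.lTensor_tmul, hx.comul, TensorProduct.sum_tmul,
      TensorProduct.tmul_sum, LinearEquiv.coe_coe, TensorProduct.assoc_tmul]
    exact Finset.sum_comm
  counit v := by
    let ρ := (Pi.basisFun k J).constr k fun l => ∑ j, Pi.basisFun k J j ⊗ₜ[k] x j l
    refine LinearMap.congr_fun (f := (CoalgebraStruct.counit (R := k) (A := A)).lTensor (J → k) ∘ₗ ρ)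
      (g := (TensorProduct.mk k (J → k) k).flip 1) ((Pi.basisFun k J).ext fun l => ?_) v
    simp only [LinearMap.comp_apply, ρ, Module.Basis.constr_basis, map_sum,
      LinearMap.lTensor_tmul, hx.counit, Matrix.one_apply, TensorProduct.tmul_ite]
    simp

theorem ofComatrix_ρ {J : Type} [Fintype J] [DecidableEq J] {x : Matrix J J A}
    (hx : IsComatrix k x) (l : J) : (ofComatrix hx).ρ (Pi.basisFun k J l) =
      ∑ j, Pi.basisFun k J j ⊗ₜ[k] x j l :=
  (Pi.basisFun k J).constr_basis k (fun l => ∑ j, Pi.basisFun k J j ⊗ₜ[k] x j l) l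

end FinRep

/-! ### The equivalence with the category of representations of a single group scheme -/

/-- The restricted ultraproduct of the categories `FinRep (k i) (A i)`. -/
abbrev RepProd {I : Type u} (U : Ultrafilter I) (k : I → Type u) [∀ i, Field (k i)]
    (A : I → Type u) [∀ i, CommRing (A i)] [∀ i, HopfAlgebra (k i) (A i)] :=
  ResProd U fun i => FinRep.forget (k i) (A i)

namespace RepProd

open UProd CoeffAlg

variable {I : Type u} {U : Ultrafilter I} {k : I → Type u} [∀ i, Field (k i)]
    {A : I → Type u} [∀ i, CommRing (A i)] [∀ i, HopfAlgebra (k i) (A i)]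

theorem tensorIncl_rTensor {V : I → Type*} [∀ i, AddCommGroup (V i)] [∀ i, Module (k i) (V i)]
    {W : I → Type*} [∀ i, AddCommGroup (W i)] [∀ i, Module (k i) (W i)]
    (f : ∀ i, V i →ₗ[k i] W i) (t : UProd U V ⊗[UProd U k] CoeffAlg U k A) :
    tensorIncl W ((mapₗ U f).rTensor _ t) =
      mapₗ U (fun i => (f i).rTensor (A i)) (tensorIncl V t) := by
  induction t using TensorProduct.induction_on with
  | zero => simp only [map_zero]
  | add s t hs ht => simp only [map_add, hs, ht]
  | tmul v b =>
    obtain ⟨v, rfl⟩ := mk_surjective v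
    obtain ⟨a, ha⟩ := mk_surjective (incl b)
    simp only [LinearMap.rTensor_tmul, tensorIncl_tmul, mapₗ_mk, ← ha, tensorMap_mk]

theorem tensorIncl_tmul_coeff {V : I → Type*} [∀ i, AddCommGroup (V i)] [∀ i, Module (k i) (V i)]
    {J : Type} [Fintype J] [DecidableEq J] {x : ∀ i, Matrix J J (A i)}
    (hx : ∀ i, IsComatrix (k i) (x i)) (v : ∀ i, V i) (j l : J) :
    tensorIncl V (mk U v ⊗ₜ coeff hx j l) = mk U fun i => v i ⊗ₜ[k i] x i j l := rfl

/-- A bounded family has one exact dimension n almost everywhere, so bases and their coefficient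
matrices can be chosen of a uniform size. -/
theorem exists_comatrix (X : RepProd U k A) :
    ∃ (n : ℕ) (b : Fin n → ∀ i, (X.obj.obj i).V) (x : ∀ i, Matrix (Fin n) (Fin n) (A i)),
      (∀ i, IsComatrix (k i) (x i)) ∧
      (∀ᶠ i in (U : Filter I), ∀ l, (X.obj.obj i).ρ (b l i) = ∑ j, b j i ⊗ₜ[k i] x i j l) ∧
      Submodule.span (UProd U k) (Set.range fun l => mk U (b l)) = ⊤ := by
  obtain ⟨N, hN⟩ := X.property
  obtain ⟨n, hn⟩ : ∃ n, ∀ᶠ i in (U : Filter I),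
      Module.finrank (k i) (X.obj.obj i).V = n := by
    -- If no dimension occurred almost everywhere, the finitely many values up to N could be
    -- excluded simultaneously.
    by_contra h
    simp only [not_exists, ← Ultrafilter.eventually_not] at h
    obtain ⟨i, h1, h2⟩ := (hN.and ((Finset.eventually_all (Finset.range (N + 1))).2
      fun n _ => h n)).exists
    exact h2 _ (Finset.mem_range.2 (Nat.lt_succ_of_le h1)) rfl
  have key : ∀ᶠ i in (U : Filter I), ∃ b : Module.Basis (Fin n) (k i) (X.obj.obj i).V, True :=
    hn.mono fun i hi => ⟨Module.finBasisOfFinrankEq _ _ hi, trivial⟩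
  have key' : ∀ᶠ i in (U : Filter I), ∃ b : Fin n → (X.obj.obj i).V,
      ∃ x : {x : Matrix (Fin n) (Fin n) (A i) // IsComatrix (k i) x},
        (∀ l, (X.obj.obj i).ρ (b l) = ∑ j, b j ⊗ₜ[k i] x.1 j l) ∧
        ∀ v, ∃ a : Fin n → k i, ∑ l, a l • b l = v := key.mono fun i ⟨b, _⟩ => by
    obtain ⟨x, hx, h⟩ := (X.obj.obj i).exists_isComatrix b
    exact ⟨b, ⟨x, hx⟩, h, fun v => ⟨b.repr v, b.sum_repr v⟩⟩
  -- The identity matrix makes the type of comatrices nonempty; choosing within it yields a comatrix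
  -- at every index, as `coeff` requires, not just almost everywhere.
  have (i : I) : Nonempty {x : Matrix (Fin n) (Fin n) (A i) // IsComatrix (k i) x} :=
    ⟨⟨_, .one⟩⟩
  obtain ⟨b, hb⟩ := eventually_exists_iff.1 key'
  obtain ⟨x, hx⟩ := eventually_exists_iff.1 hb
  refine ⟨n, fun l i => b i l, fun i => (x i).1, fun i => (x i).2, hx.mono fun i hi => hi.1,
    eq_top_iff.2 fun v _ => ?_⟩
  obtain ⟨v, rfl⟩ := mk_surjective v
  obtain ⟨a, ha⟩ := eventually_exists_iff.1 (hx.mono fun i hi => hi.2 (v i))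
  have : mk U v = ∑ l, (mk U fun i => a i l) • mk U fun i => b i l := by
    simp only [mk_smul, mk_sum]
    exact mk_eq_mk.2 (ha.mono fun i hi => hi.symm)
  rw [this]
  exact Submodule.sum_mem _ fun l _ => Submodule.smul_mem _ _ (Submodule.subset_span ⟨l, rfl⟩)

/-- On the spanning classes of basis vectors the componentwise coaction is a sum of n terms with
coefficients in B. So it takes values in the embedded ∏V_i ⊗ B, and a left inverse of the embedding
corestricts it. -/
theorem exists_coact (X : RepProd U k A) :
    ∃ φ : (UProd U fun i => (X.obj.obj i).V) →ₗ[UProd U k]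
        (UProd U fun i => (X.obj.obj i).V) ⊗[UProd U k] CoeffAlg U k A,
      tensorIncl _ ∘ₗ φ = mapₗ U fun i => (X.obj.obj i).ρ := by
  obtain ⟨n, b, x, hx, h, hb⟩ := exists_comatrix X
  obtain ⟨r, hr⟩ := LinearMap.exists_leftInverse_of_injective _ (LinearMap.ker_eq_bot.2
    (tensorIncl_injective (U := U) (k := k) (A := A) fun i => (X.obj.obj i).V))
  refine ⟨r ∘ₗ mapₗ U fun i => (X.obj.obj i).ρ, LinearMap.ext_on_range hb fun l => ?_⟩
  have : mapₗ U (fun i => (X.obj.obj i).ρ) (mk U (b l)) =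
      tensorIncl _ (∑ j, mk U (b j) ⊗ₜ coeff hx j l) := by
    simp only [map_sum, tensorIncl_tmul_coeff, mk_sum]
    exact mk_eq_mk.2 (h.mono fun i hi => hi l)
  rw [LinearMap.comp_apply, LinearMap.comp_apply, this]
  exact congrArg _ (LinearMap.congr_fun hr _)

/-- The coaction on an ultraproduct of representations. -/
noncomputable def coact (X : RepProd U k A) :
    (UProd U fun i => (X.obj.obj i).V) →ₗ[UProd U k]
      (UProd U fun i => (X.obj.obj i).V) ⊗[UProd U k] CoeffAlg U k A :=
  (exists_coact X).choose

theorem tensorIncl_coact (X : RepProd U k A) (v : UProd U fun i => (X.obj.obj i).V) :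
    tensorIncl _ (coact X v) = mapₗ U (fun i => (X.obj.obj i).ρ) v :=
  LinearMap.congr_fun (exists_coact X).choose_spec v

theorem exists_coact_eq (X : RepProd U k A) :
    ∃ (n : ℕ) (b : Fin n → UProd U fun i => (X.obj.obj i).V)
      (x : ∀ i, Matrix (Fin n) (Fin n) (A i)) (hx : ∀ i, IsComatrix (k i) (x i)),
      (∀ l, coact X (b l) = ∑ j, b j ⊗ₜ coeff hx j l) ∧
      Submodule.span (UProd U k) (Set.range b) = ⊤ := by
  obtain ⟨n, b, x, hx, h, hb⟩ := exists_comatrix X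
  refine ⟨n, fun l => mk U (b l), x, hx, fun l => tensorIncl_injective _ ?_, hb⟩
  rw [tensorIncl_coact]
  simp only [map_sum, tensorIncl_tmul_coeff, mk_sum]
  exact mk_eq_mk.2 (h.mono fun i hi => hi l)

/-- The representation `∏_U V i`. -/
noncomputable def toFinRep (X : RepProd U k A) : FinRep (UProd U k) (CoeffAlg U k A) where
  V := (resFunctor U fun i => FinRep.forget (k i) (A i)).obj X
  ρ := coact X
  coassoc v := by
    obtain ⟨n, b, x, hx, h, hb⟩ := exists_coact_eq X
    refine LinearMap.congr_fun (f := (TensorProduct.assoc (UProd U k) _ _ _).toLinearMap ∘ₗ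
      (coact X).rTensor _ ∘ₗ coact X) (g := CoalgebraStruct.comul.lTensor _ ∘ₗ coact X)
      (LinearMap.ext_on_range hb fun l => ?_) v
    simp only [LinearMap.comp_apply, h, map_sum, LinearMap.rTensor_tmul, LinearMap.lTensor_tmul,
      comul_coeff, TensorProduct.sum_tmul, TensorProduct.tmul_sum, LinearEquiv.coe_coe,
      TensorProduct.assoc_tmul]
    exact Finset.sum_comm
  counit v := by
    obtain ⟨n, b, x, hx, h, hb⟩ := exists_coact_eq X
    refine LinearMap.congr_fun (f := CoalgebraStruct.counit.lTensor _ ∘ₗ coact X)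
      (g := (TensorProduct.mk (UProd U k) _ _).flip 1) (LinearMap.ext_on_range hb fun l => ?_) v
    simp only [LinearMap.comp_apply, h, map_sum, LinearMap.lTensor_tmul, counit_coeff,
      Matrix.one_apply, TensorProduct.tmul_ite]
    simp

end RepProd

/-! ### The functor to representations and its full faithfulness -/

namespace RepProd

open UProd CoeffAlg

variable {I : Type u} {U : Ultrafilter I} {k : I → Type u} [∀ i, Field (k i)]
    {A : I → Type u} [∀ i, CommRing (A i)] [∀ i, HopfAlgebra (k i) (A i)]

/-- Embedding ∏W_i ⊗ B in ∏(W_i ⊗ A_i), where W is the target, makes both sides componentwise, and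
Łoś's principle for ∀ concludes. One direction makes the functor well defined on morphisms, the
other makes it full. -/
theorem mapₗ_coact_iff (X Y : RepProd U k A)
    (f : ∀ i, (X.obj.obj i).V →ₗ[k i] (Y.obj.obj i).V) :
    (∀ v, coact Y (mapₗ U f v) = (mapₗ U f).rTensor _ (coact X v)) ↔
      ∀ᶠ i in (U : Filter I), ∀ v, (Y.obj.obj i).ρ (f i v) =
        (f i).rTensor (A i) ((X.obj.obj i).ρ v) := by
  rw [eventually_forall_iff]
  have h (v : UProd U fun i => (X.obj.obj i).V) :
      coact Y (mapₗ U f v) = (mapₗ U f).rTensor _ (coact X v) ↔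
        mapₗ U (fun i => (Y.obj.obj i).ρ) (mapₗ U f v) =
          mapₗ U (fun i => (f i).rTensor (A i)) (mapₗ U (fun i => (X.obj.obj i).ρ) v) := by
    rw [← (tensorIncl_injective _).eq_iff, tensorIncl_coact, tensorIncl_rTensor, tensorIncl_coact]
  exact ⟨fun H v => mk_eq_mk.1 ((h (mk U v)).1 (H _)),
    fun H => ind fun v => (h _).2 (mk_eq_mk.2 (H v))⟩

variable (U k A) in
/-- The functor `[V i] ↦ ∏_U V i`. -/
noncomputable def functor : RepProd U k A ⥤ FinRep (UProd U k) (CoeffAlg U k A) where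
  obj X := toFinRep X
  map {X Y} f := FinRep.homMk ((resFunctor U fun i => FinRep.forget (k i) (A i)).map f) (by
    obtain ⟨f, rfl⟩ := ResProd.homMk_surjective f
    exact (mapₗ_coact_iff X Y fun i => (f i).1.hom.hom).2
      (Filter.Eventually.of_forall fun i => (f i).2))
  map_id X := Subtype.ext ((resFunctor U fun i => FinRep.forget (k i) (A i)).map_id X)
  map_comp f g := Subtype.ext ((resFunctor U fun i => FinRep.forget (k i) (A i)).map_comp f g)

instance (i : I) : (FinRep.forget (k i) (A i)).Additive where

instance (i : I) : (FinRep.forget (k i) (A i)).Linear (k i) where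

instance : (functor U k A).Additive where
  map_add := Subtype.ext (resFunctor U fun i => FinRep.forget (k i) (A i)).map_add

instance : (functor U k A).Linear (UProd U k) where
  map_smul f a := Subtype.ext ((resFunctor U fun i => FinRep.forget (k i) (A i)).map_smul a f)

instance : (functor U k A).Faithful where
  map_injective h :=
    (resFunctor U fun i => FinRep.forget (k i) (A i)).map_injective (congrArg Subtype.val h)

instance : (functor U k A).Full where
  map_surjective {X Y} φ := by
    obtain ⟨f, hf⟩ : ∃ f : ∀ i, (X.obj.obj i).V →ₗ[k i] (Y.obj.obj i).V,
        mapₗ U f = φ.1.hom.hom := exists_mapₗ_eq X.property.choose_spec _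
    have h : ∀ᶠ i in (U : Filter I), ∀ v, (Y.obj.obj i).ρ (f i v) =
        (f i).rTensor (A i) ((X.obj.obj i).ρ v) := (mapₗ_coact_iff X Y f).1 (by
      rw [hf]
      exact φ.2)
    have h' : ∀ᶠ i in (U : Filter I), ∃ g : X.obj.obj i ⟶ Y.obj.obj i, g.1.hom.hom = f i :=
      h.mono fun i hi => ⟨FinRep.homMk (ObjectProperty.homMk (ModuleCat.ofHom (f i))) hi, rfl⟩
    obtain ⟨g, hg⟩ := eventually_exists_iff.1 h'
    refine ⟨ResProd.homMk g, Subtype.ext (FGModuleCat.hom_ext ?_)⟩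
    exact (mapₗ_eq_iff.2 hg).trans hf

/-! ### Essential surjectivity -/

section EssSurj

/-- The ultraproduct of the k_i^n is k^n, with the classes of the constant standard vectors as
basis. -/
theorem bijective_constr_single {n : ℕ} {V : Type*} [AddCommGroup V] [Module (UProd U k) V]
    (b : Module.Basis (Fin n) (UProd U k) V) : Function.Bijective
      (b.constr (UProd U k) fun l => mk U fun i => Pi.basisFun (k i) (Fin n) l) := by
  have key (a : Fin n → ∀ i, k i) : ∑ l, mk U (a l) •
      (mk U fun i => Pi.basisFun (k i) (Fin n) l) = mk U fun i l => a l i := by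
    simp only [mk_smul, mk_sum]
    refine mk_congr fun i => funext fun l => ?_
    simp [Finset.sum_apply, Pi.single_apply]
  constructor
  · rw [← LinearMap.ker_eq_bot, LinearMap.ker_eq_bot']
    intro v hv
    obtain ⟨a, ha⟩ := exists_mk fun l => b.repr v l
    rw [Module.Basis.constr_apply_fintype] at hv
    simp only [Module.Basis.equivFun_apply, ← ha, key] at hv
    rw [← b.sum_repr v]
    refine Finset.sum_eq_zero fun l _ => ?_
    have h0 : mk U (a l) = 0 := mk_eq_mk.2 ((mk_eq_mk.1 hv).mono fun i hi => congrFun hi l)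
    rw [← ha, h0, zero_smul]
  · refine ind fun v => ⟨∑ l, (mk U fun i => v i l) • b l, ?_⟩
    simp only [map_sum, map_smul, Module.Basis.constr_basis, key]

theorem tensorIncl_comul (b : CoeffAlg U k A) :
    tensorIncl A (incl.rTensor _ (CoalgebraStruct.comul (R := UProd U k) b)) =
      mapₗ U (fun i => CoalgebraStruct.comul (R := k i) (A := A i)) (incl b) := by
  refine LinearMap.congr_fun (f := tensorIncl A ∘ₗ incl.rTensor _ ∘ₗ CoalgebraStruct.comul)
    (g := mapₗ U (fun i => CoalgebraStruct.comul) ∘ₗ incl) (linearMap_ext fun hx j l => ?_) b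
  simp only [LinearMap.comp_apply, comul_coeff, map_sum, LinearMap.rTensor_tmul, incl_coeff,
    tensorIncl_tmul_coeff, mapₗ_mk, mk_sum]
  exact mk_congr fun i => ((hx i).comul j l).symm

/-- Lift the entries to ∏A_i. By `tensorIncl_comul` the comatrix identities over B become
componentwise ones, so the lifts are comatrices for almost every i and can be replaced elsewhere. -/
theorem exists_isComatrix_lift {n : ℕ} {y : Matrix (Fin n) (Fin n) (CoeffAlg U k A)}
    (hy : IsComatrix (UProd U k) y) :
    ∃ (x : ∀ i, Matrix (Fin n) (Fin n) (A i)) (hx : ∀ i, IsComatrix (k i) (x i)),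
      ∀ j l, y j l = coeff hx j l := by
  choose z hz using fun j l => mk_surjective (incl (y j l))
  have h1 : ∀ j l, ∀ᶠ i in (U : Filter I),
      CoalgebraStruct.comul (R := k i) (z j l i) = ∑ m, z j m i ⊗ₜ[k i] z m l i := fun j l => by
    have h := tensorIncl_comul (y j l)
    rw [hy.comul, ← hz] at h
    simp only [map_sum, LinearMap.rTensor_tmul, tensorIncl_tmul, ← hz, tensorMap_mk, mk_sum] at h
    exact (mk_eq_mk.1 h).mono fun i hi => hi.symm
  have h2 : ∀ j l, ∀ᶠ i in (U : Filter I),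
      CoalgebraStruct.counit (R := k i) (z j l i) = (1 : Matrix (Fin n) (Fin n) (k i)) j l :=
    fun j l => by
      have h : map (fun i => CoalgebraStruct.counit (R := k i)) (incl (y j l)) = _ := hy.counit j l
      rw [← hz] at h
      refine mk_eq_mk.1 (h.trans ?_)
      by_cases hjl : j = l
      · subst hjl
        simp only [Matrix.one_apply_eq]
        rfl
      · simp only [Matrix.one_apply_ne hjl]
        rfl
  have h3 : ∀ᶠ i in (U : Filter I),
      ∃ x : {x : Matrix (Fin n) (Fin n) (A i) // IsComatrix (k i) x}, ∀ j l, x.1 j l = z j l i := by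
    -- There are finitely many entries, so their identities hold simultaneously for almost every i.
    simp only [← Filter.eventually_all] at h1 h2
    exact (h1.and h2).mono fun i hi => ⟨⟨Matrix.of fun j l => z j l i, hi.1, hi.2⟩, fun _ _ => rfl⟩
  have (i : I) : Nonempty {x : Matrix (Fin n) (Fin n) (A i) // IsComatrix (k i) x} :=
    ⟨⟨_, .one⟩⟩
  obtain ⟨x, hx⟩ := eventually_exists_iff.1 h3
  refine ⟨fun i => (x i).1, fun i => (x i).2, fun j l => incl_injective ?_⟩
  rw [incl_coeff, ← hz]
  exact mk_eq_mk.2 (hx.mono fun i hi => (hi j l).symm)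

/-- The coefficient matrix of Y in a basis lifts to matrices x_i, and the comodules k_i^n which
these define have ultraproduct isomorphic to Y. Matching the bases respects the coactions, as both
have the same matrix over B. -/
instance : (functor U k A).EssSurj where
  mem_essImage Y := by
    let b := Module.finBasis (UProd U k) Y.V
    obtain ⟨y, hy, h⟩ := Y.exists_isComatrix b
    obtain ⟨x, hx, hyx⟩ := exists_isComatrix_lift hy
    let X : RepProd U k A := ⟨⟨fun i => FinRep.ofComatrix (hx i)⟩, Module.finrank (UProd U k) Y.V,
      Filter.Eventually.of_forall fun i => by
        change Module.finrank (k i) (Fin _ → k i) ≤ _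
        rw [Module.finrank_fin_fun]⟩
    let e := LinearEquiv.ofBijective _ (bijective_constr_single b)
    let e' : Y.V ≅ (toFinRep X).V := (ModuleCat.isFG _).isoMk (LinearEquiv.toModuleIso e)
    refine ⟨X, ⟨(FinRep.isoMk (X := Y) (Y := toFinRep X) e' fun v => ?_).symm⟩⟩
    refine LinearMap.congr_fun (f := coact X ∘ₗ e.toLinearMap)
      (g := e.toLinearMap.rTensor _ ∘ₗ Y.ρ) (b.ext fun l => ?_) v
    have he (l) : e (b l) = mk U fun i => Pi.basisFun (k i) (Fin _) l :=
      b.constr_basis (UProd U k) (fun l => mk U fun i => Pi.basisFun (k i) (Fin _) l) l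
    have hr : e.toLinearMap.rTensor (CoeffAlg U k A) (Y.ρ (b l)) =
        ∑ j, (mk U fun i => Pi.basisFun (k i) (Fin _) j) ⊗ₜ coeff hx j l := by
      rw [h, map_sum]
      exact Finset.sum_congr rfl fun j _ => congrArg₂ (· ⊗ₜ ·) (he j) (hyx j l)
    have hr' : tensorIncl (fun i => Fin _ → k i)
        (∑ j, (mk U fun i => Pi.basisFun (k i) (Fin _) j) ⊗ₜ coeff hx j l) =
          mk U fun i => ∑ j, Pi.basisFun (k i) (Fin _) j ⊗ₜ[k i] x i j l := by
      simp only [map_sum, tensorIncl_tmul_coeff, mk_sum]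
    have hl : tensorIncl _ (coact X (e (b l))) =
        mk U fun i => ∑ j, Pi.basisFun (k i) (Fin _) j ⊗ₜ[k i] x i j l :=
      (congrArg (fun v => tensorIncl _ (coact X v)) (he l)).trans
        ((tensorIncl_coact X _).trans (mk_congr fun i => FinRep.ofComatrix_ρ (hx i) l))
    exact tensorIncl_injective _ (hl.trans ((congrArg (tensorIncl _) hr).trans hr').symm)

instance : (functor U k A).IsEquivalence where

end EssSurj

/-! ### The tensor structure of the functor -/

section Monoidal

/-- Both sides are biadditive in s and t, which reduces the claim to pure tensors; there it says
that B multiplies componentwise inside ∏A_i. -/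
theorem tensorIncl_tensorMul {V : I → Type*} [∀ i, AddCommGroup (V i)] [∀ i, Module (k i) (V i)]
    {W : I → Type*} [∀ i, AddCommGroup (W i)] [∀ i, Module (k i) (W i)]
    (s : UProd U V ⊗[UProd U k] CoeffAlg U k A)
    (t : UProd U W ⊗[UProd U k] CoeffAlg U k A) :
    tensorIncl (fun i => V i ⊗[k i] W i)
        ((tensorMap U k V W).rTensor _ (tensorMul _ _ _ _ (s ⊗ₜ t))) =
      map₂ (fun i s t => tensorMul (k i) (V i) (W i) (A i) (s ⊗ₜ t))
        (tensorIncl _ s) (tensorIncl _ t) := by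
  let F (i : I) (s : V i ⊗[k i] A i) (t : W i ⊗[k i] A i) :=
    tensorMul (k i) (V i) (W i) (A i) (s ⊗ₜ t)
  change _ = map₂ F _ _
  have add_left : ∀ a b c, map₂ (U := U) F (a + b) c = map₂ F a c + map₂ F b c :=
    ind fun _ => ind fun _ => ind fun _ => mk_congr fun i => by
      simp only [F, TensorProduct.add_tmul, map_add]
  have add_right : ∀ a b c, map₂ (U := U) F a (b + c) = map₂ F a b + map₂ F a c :=
    ind fun _ => ind fun _ => ind fun _ => mk_congr fun i => by
      simp only [F, TensorProduct.tmul_add, map_add]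
  have zero_left : ∀ c, map₂ (U := U) F 0 c = 0 := ind fun _ => mk_congr fun i => by
    simp only [F, TensorProduct.zero_tmul, map_zero]
  have zero_right : ∀ c, map₂ (U := U) F c 0 = 0 := ind fun _ => mk_congr fun i => by
    simp only [F, TensorProduct.tmul_zero, map_zero]
  induction s using TensorProduct.induction_on with
  | zero => simp only [TensorProduct.zero_tmul, map_zero, zero_left]
  | add s s' hs hs' => simp only [TensorProduct.add_tmul, map_add, add_left, hs, hs']
  | tmul v a =>
    induction t using TensorProduct.induction_on with
    | zero => simp only [TensorProduct.tmul_zero, map_zero, zero_right]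
    | add t t' ht ht' => simp only [TensorProduct.tmul_add, map_add, add_right, ht, ht']
    | tmul w b =>
      obtain ⟨v, rfl⟩ := mk_surjective v
      obtain ⟨w, rfl⟩ := mk_surjective w
      obtain ⟨a', ha⟩ := mk_surjective (incl a)
      obtain ⟨b', hb⟩ := mk_surjective (incl b)
      have hab : incl (a * b) = mk U fun i => a' i * b' i := by
        rw [← mk_mul, ha, hb]
        rfl
      rw [tensorMul_tmul, LinearMap.rTensor_tmul, tensorIncl_tmul, tensorIncl_tmul,
        tensorIncl_tmul, hab, ← ha, ← hb]
      exact mk_congr fun i => (tensorMul_tmul _ _ _ _).symm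

theorem tensorMap_coact (X Y : RepProd U k A)
    (t : (UProd U fun i => (X.obj.obj i).V) ⊗[UProd U k] (UProd U fun i => (Y.obj.obj i).V)) :
    coact (X ⊗ Y) (tensorMap U k (fun i => (X.obj.obj i).V) (fun i => (Y.obj.obj i).V) t) =
      (tensorMap U k (fun i => (X.obj.obj i).V) (fun i => (Y.obj.obj i).V)).rTensor _
        (FinRep.tensorCoact (coact X) (coact Y) t) := by
  refine tensorIncl_injective _ ((tensorIncl_coact (X ⊗ Y) _).trans ?_)
  induction t using TensorProduct.induction_on with
  | zero => simp only [map_zero]; exact map_zero _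
  | add s t hs ht =>
    simp only [map_add]
    exact (map_add _ _ _).trans ((congrArg₂ (· + ·) hs ht).trans (map_add _ _ _).symm)
  | tmul v w =>
    refine Eq.trans ?_ (tensorIncl_tensorMul (coact X v) (coact Y w)).symm
    rw [tensorIncl_coact, tensorIncl_coact]
    obtain ⟨v, rfl⟩ := mk_surjective v
    obtain ⟨w, rfl⟩ := mk_surjective w
    rfl

theorem resMu_eq (X Y : RepProd U k A) : (ResProd.resMu X Y).toLinearMap =
    tensorMap U k (fun i => (X.obj.obj i).V) (fun i => (Y.obj.obj i).V) :=
  TensorProduct.ext' (ind fun _ => ind fun _ => rfl)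

theorem resMu_coact (X Y : RepProd U k A)
    (t : (UProd U fun i => (X.obj.obj i).V) ⊗[UProd U k] (UProd U fun i => (Y.obj.obj i).V)) :
    coact (X ⊗ Y) (ResProd.resMu X Y t) =
      (ResProd.resMu X Y).toLinearMap.rTensor _ (FinRep.tensorCoact (coact X) (coact Y) t) :=
  (congrArg (fun f => coact (X ⊗ Y) (f t)) (resMu_eq X Y)).trans ((tensorMap_coact X Y t).trans
    (congrArg (fun f => f.rTensor _ (FinRep.tensorCoact (coact X) (coact Y) t))
      (resMu_eq X Y)).symm)

theorem resEpsilon_coact (a : UProd U k) :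
    coact (𝟙_ (RepProd U k A))
        (ResProd.resEpsilon (ω := fun i => FinRep.forget (k i) (A i)) a) =
      (ResProd.resEpsilon (ω := fun i => FinRep.forget (k i) (A i))).toLinearMap.rTensor _
        (a ⊗ₜ (1 : CoeffAlg U k A)) := by
  refine tensorIncl_injective _ ((tensorIncl_coact (𝟙_ (RepProd U k A)) _).trans ?_)
  obtain ⟨a, rfl⟩ := mk_surjective a
  rfl

variable (U k A) in
/-- The tensor structure of `functor`. -/
noncomputable def functorCore : (functor U k A).CoreMonoidal where
  εIso := FinRep.isoMk
    (Functor.Monoidal.εIso (resFunctor U fun i => FinRep.forget (k i) (A i))) resEpsilon_coact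
  μIso X Y := FinRep.isoMk
    (Functor.Monoidal.μIso (resFunctor U fun i => FinRep.forget (k i) (A i)) X Y) (resMu_coact X Y)
  -- Morphisms of representations are linear maps with a property, so naturality and coherence are
  -- inherited from `resFunctor`.
  μIso_hom_natural_left f Z := Subtype.ext
    (Functor.LaxMonoidal.μ_natural_left (resFunctor U fun i => FinRep.forget (k i) (A i)) f Z)
  μIso_hom_natural_right Z f := Subtype.ext
    (Functor.LaxMonoidal.μ_natural_right (resFunctor U fun i => FinRep.forget (k i) (A i)) Z f)
  associativity X Y Z := Subtype.ext
    (Functor.LaxMonoidal.associativity (resFunctor U fun i => FinRep.forget (k i) (A i)) X Y Z)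
  left_unitality X := Subtype.ext
    (Functor.LaxMonoidal.left_unitality (resFunctor U fun i => FinRep.forget (k i) (A i)) X)
  right_unitality X := Subtype.ext
    (Functor.LaxMonoidal.right_unitality (resFunctor U fun i => FinRep.forget (k i) (A i)) X)

noncomputable instance : (functor U k A).Monoidal := (functorCore U k A).toMonoidal

noncomputable instance : (functor U k A).Braided where
  braided X Y := Subtype.ext
    (Functor.LaxBraided.braided (F := resFunctor U fun i => FinRep.forget (k i) (A i)) X Y)

end Monoidal

end RepProd

/-! ### The main theorem -/

theorem mainTheorem1 {I : Type u} (U : Ultrafilter I) (k : I → Type u) [∀ i, Field (k i)] :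
    -- the restricted ultraproduct of neutral tannakian categories is tannakian over `∏_U k i`,
    -- and `[X i] ↦ ∏_U ω i (X i)` is a fibre functor on it
    (∀ (C : I → Type u₁) [∀ i, Category.{u} (C i)] [∀ i, Preadditive (C i)]
        [∀ i, Linear (k i) (C i)] [∀ i, MonoidalCategory (C i)] [∀ i, SymmetricCategory (C i)]
        [∀ i, IsTannakian (k i) (C i)]
        (ω : ∀ i, C i ⥤ FGModuleCat.{u} (k i)) [∀ i, (ω i).Braided]
        [∀ i, IsFibreFunctor (k i) (ω i)],
      IsTannakian (UProd U k) (ResProd U ω) ∧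
      ∃ _ : (resFunctor U ω).Braided,
        (∀ (X Y : ResProd U ω) (v : ∀ i, (ω i).obj (X.obj.obj i))
            (w : ∀ i, (ω i).obj (Y.obj.obj i)),
          (Functor.LaxMonoidal.μ (resFunctor U ω) X Y).hom.hom
              (UProd.mk U v ⊗ₜ[UProd U k] UProd.mk U w) =
            UProd.mk U fun i =>
              (Functor.LaxMonoidal.μ (ω i) (X.obj.obj i) (Y.obj.obj i)).hom.hom
                (v i ⊗ₜ[k i] w i)) ∧
        (∀ a : ∀ i, k i,
          (Functor.LaxMonoidal.ε (resFunctor U ω)).hom.hom (UProd.mk U a) =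
            UProd.mk U fun i => (Functor.LaxMonoidal.ε (ω i)).hom.hom (a i)) ∧
        IsFibreFunctor (UProd U k) (resFunctor U ω)) ∧
    -- the restricted ultraproduct of the categories `Rep (G i)` is tensor equivalent to `Rep G`
    (∀ (A : I → Type u) [∀ i, CommRing (A i)] [∀ i, HopfAlgebra (k i) (A i)],
      ∃ (B : Type u) (_ : CommRing B) (_ : HopfAlgebra (UProd U k) B)
        (F : ResProd U (fun i => FinRep.forget (k i) (A i)) ⥤ FinRep (UProd U k) B)
        (_ : F.Braided) (_ : F.Additive),
        F.IsEquivalence ∧ F.Linear (UProd U k)) := by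
  refine ⟨fun C _ _ _ _ _ _ ω _ _ => ?_, fun A _ _ => ?_⟩
  · obtain ⟨h, h'⟩ := isTannakian_and_isFibreFunctor_resFunctor U ω
    -- The formulas for the constraints hold by definition, since the constraints were built from
    -- the comparison map and the componentwise constraints.
    exact ⟨h, inferInstance, fun X Y v w => rfl, fun a => rfl, h'⟩
  · exact ⟨UProd.CoeffAlg U k A, inferInstance, inferInstance, RepProd.functor U k A,
      inferInstance, inferInstance, inferInstance, inferInstance⟩
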